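/- **Setting.** Let $B\subset A$ be a unital inclusion of unital $C^*$-algebras, $\tau$ a faithful tracial state on $A$, and $E:A\to B$ a positive conditional expectation (linear, $E[b]=b$, $E[bac]=bE[a]c$, $E[a^*a]\ge 0$ for $a\in A$, $b,c\in B$) with $\tau\circ E=\tau$. Let $d$ be a natural number and $\eta_1,\dots,\eta_d:B\to B$ completely positive maps that are $\tau$-symmetric, i.e. $\tau(\eta_j(b)c)=\tau(b\,\eta_j(c))$ for all $b,c\in B$. **Polynomials.** $B_{\langle d\rangle}=B\langle X_1,\dots,X_d\rangle$ is the algebraic free product over $\mathbb C$ of $B$ and the algebra $\mathbb C\langle X_1,\dots,X_d\rangle$ of non-commutative polynomials; $\mathrm{ev}_S:B_{\langle d\rangle}\to A$, $P\mapsto P(S)$, is the homomorphism with $b\mapsto b$, $X_j\mapsto S_j$. The free difference quotient $\partial_j:B_{\langle d\rangle}\to B_{\langle d\rangle}\otimes B_{\langle d\rangle}$ is the derivation, $\partial_j(PQ)=(P\otimes1)\,\partial_jQ+\partial_jP\,(1\otimes Q)$, with $\partial_j b=0$ for $b\in B$ and $\partial_jX_i=\delta_{ij}\,1\otimes1$.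 **Norms.** $\|a\|_\tau^2=\tau(a^*a)$ for $a\in A$, and $\|\xi\|_{\eta_j}^2=\langle\xi,\xi\rangle_{\eta_j}$ for $\xi$ in the algebraic tensor product $A\otimes A$, where $\langle a_1\otimes a_2,a_3\otimes a_4\rangle_{\eta_j}=\tau\big(a_2^*\,\eta_j(E[a_1^*a_3])\,a_4\big)$, extended conjugate-linearly in the first and linearly in the second argument. **Freeness and semicircularity.** $S_1,\dots,S_d\in A$ are $B$-free if $$E\big[(P_1(S_{i(1)})-E[P_1(S_{i(1)})])\cdots(P_k(S_{i(k)})-E[P_k(S_{i(k)})])\big]=0$$ for all $k\ge1$, all $P_1,\dots,P_k\in B\langle X\rangle$ and all $i(1),\dots,i(k)\in\{1,\dots,d\}$ with $i(t)\ne i(t+1)$ for $1\le t<k$. An element $s=s^*\in A$ is $B$-valued semicircular with mean $0$ and variance $\eta$ if $$E[b_0sb_1s\cdots sb_k]=\sum_{\pi\in NC_2(k)}b_0\,\eta_\pi(b_1,\dots,b_{k-1})\,b_k$$ for all $k$ and all $b_0,\dots,b_k\in B$, where $NC_2(k)$ is the set of non-crossing pair partitions of $\{1,\dots,k\}$ and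 $\eta_\pi$ is obtained by applying $\eta$ along the nested blocks of $\pi$ (for example $\eta_{\{\{1,4\},\{2,3\}\}}(b_1,b_2,b_3)=\eta(b_1\eta(b_2)b_3)$ and $\eta_{\{\{1,2\},\{3,4\}\}}(b_1,b_2,b_3)=\eta(b_1)b_2\eta(b_3)$). $S_1,\dots,S_d$ is a $B$-valued semicircular system associated with $\eta_1,\dots,\eta_d$ if $S_1,\dots,S_d$ are $B$-free and each $S_j$ is $B$-valued semicircular with mean $0$ and variance $\eta_j$. **The class $\mathcal T_\eta B_{\langle d\rangle}$.** For a linear map $\eta:B\to B$, the $B$-valued Chebyshev family is defined by $U_0^\eta=1$, $U_1^\eta\left(\begin{smallmatrix}b\\b'\end{smallmatrix}\right)(X)=bXb'$ and, for $n\ge2$, $$U_n^\eta\left(\begin{smallmatrix}b_1\\b_1'\end{smallmatrix};\cdots;\begin{smallmatrix}b_n\\b_n'\end{smallmatrix}\right)=b_1Xb_1'\;U_{n-1}^\eta\left(\begin{smallmatrix}b_2\\b_2'\end{smallmatrix};\cdots;\begin{smallmatrix}b_n\\b_n'\end{smallmatrix}\right)-b_1\eta(b_1'b_2)b_2'\;U_{n-2}^\eta\left(\begin{smallmatrix}b_3\\b_3'\end{smallmatrix};\cdots;\begin{smallmatrix}b_n\\b_n'\end{smallmatrix}\right).$$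 $\mathcal T_\eta B_{\langle d\rangle}$ is the set of all sums of an element of $B$ and finitely many products $$U_{n(1)}^{\eta_{i(1)}}\left(\begin{smallmatrix}b_{1,1}\\b_{1,1}'\end{smallmatrix};\cdots;\begin{smallmatrix}b_{1,n(1)}\\b_{1,n(1)}'\end{smallmatrix}\right)(X_{i(1)})\cdots U_{n(\ell)}^{\eta_{i(\ell)}}\left(\begin{smallmatrix}b_{\ell,1}\\b_{\ell,1}'\end{smallmatrix};\cdots;\begin{smallmatrix}b_{\ell,n(\ell)}\\b_{\ell,n(\ell)}'\end{smallmatrix}\right)(X_{i(\ell)})$$ with $\ell\ge1$, $n(t)\ge1$, $i(t)\neq i(t+1)$ and entries $b_{t,s},b'_{t,s}\in B$, in which each index $(\ell,i,n)$ occurs at most once. **Theorem.** In this setting let $S_1,\dots,S_d\in A$ be self-adjoint and $B$-free with mean $0$ and variances $\eta_1,\dots,\eta_d$, i.e. $E[S_j]=0$ and $E[S_jbS_j]=\eta_j(b)$ for all $b\in B$ and all $j$. Then the following are equivalent: 1. $S_1,\dots,S_d$ is a $B$-valued semicircular system associated with $\eta_1,\dots,\eta_d$. 2. $\displaystyle\|P(S)-E[P(S)]\|_\tau^2\le\sum_{j=1}^d\big\|\mathrm{ev}_S^{\otimes2}(\partial_jP)\big\|_{\eta_j}^2$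 for all $P\in\mathcal T_\eta B_{\langle d\rangle}$. 3. The same inequality holds for all $P\in B_{\langle d\rangle}$. -/

import Mathlib

open scoped TensorProduct CStarAlgebra

noncomputable section

namespace BValued

/-! ### Non-commutative polynomials with coefficients in `B` -/

section NCPoly

/-- Relations on the free algebra on the symbols `b ∈ B` and `X i`, `i ∈ I`, which turn the
map from `B` into a homomorphism of unital algebras. -/
inductive NCPolyRel (B : Type*) [Ring B] [Algebra ℂ B] (I : Type*) :
    FreeAlgebra ℂ (B ⊕ I) → FreeAlgebra ℂ (B ⊕ I) → Prop
  | add (b c : B) : NCPolyRel B I (FreeAlgebra.ι ℂ (Sum.inl (b + c)))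
      (FreeAlgebra.ι ℂ (Sum.inl b) + FreeAlgebra.ι ℂ (Sum.inl c))
  | mul (b c : B) : NCPolyRel B I (FreeAlgebra.ι ℂ (Sum.inl (b * c)))
      (FreeAlgebra.ι ℂ (Sum.inl b) * FreeAlgebra.ι ℂ (Sum.inl c))
  | scalar (r : ℂ) : NCPolyRel B I (FreeAlgebra.ι ℂ (Sum.inl (algebraMap ℂ B r)))
      (algebraMap ℂ (FreeAlgebra ℂ (B ⊕ I)) r)

/-- `NCPoly B I` is `B⟨X i : i ∈ I⟩`, the algebraic free product over `ℂ` of the unital algebra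
`B` and the algebra of non-commutative polynomials in the indeterminates `X i`. Its universal
property is `NCPoly.lift`, `NCPoly.lift_C`, `NCPoly.lift_X` and `NCPoly.hom_ext`. -/
def NCPoly (B : Type*) [Ring B] [Algebra ℂ B] (I : Type*) : Type _ :=
  RingQuot (NCPolyRel B I)

namespace NCPoly

variable {B : Type*} [Ring B] [Algebra ℂ B] {I : Type*}

instance : Ring (NCPoly B I) := inferInstanceAs (Ring (RingQuot (NCPolyRel B I)))

instance : Algebra ℂ (NCPoly B I) := inferInstanceAs (Algebra ℂ (RingQuot (NCPolyRel B I)))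

/-- The quotient map from the free algebra. -/
def mk : FreeAlgebra ℂ (B ⊕ I) →ₐ[ℂ] NCPoly B I := RingQuot.mkAlgHom ℂ (NCPolyRel B I)

theorem mk_rel {x y : FreeAlgebra ℂ (B ⊕ I)} (h : NCPolyRel B I x y) :
    (mk x : NCPoly B I) = mk y := RingQuot.mkAlgHom_rel ℂ h

/-- The inclusion of the coefficient algebra. -/
def C : B →ₐ[ℂ] NCPoly B I :=
  AlgHom.mk'
    { toFun := fun b => mk (FreeAlgebra.ι ℂ (Sum.inl b))
      map_one' := by
        have h := mk_rel (NCPolyRel.scalar (B := B) (I := I) 1)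
        simpa using h
      map_mul' := fun b c => by
        have h := mk_rel (NCPolyRel.mul (I := I) b c)
        simpa using h
      map_zero' := by
        have h := mk_rel (NCPolyRel.scalar (B := B) (I := I) 0)
        simpa using h
      map_add' := fun b c => by
        have h := mk_rel (NCPolyRel.add (I := I) b c)
        simpa using h }
    (fun r b => by
      have h1 := mk_rel (NCPolyRel.mul (I := I) (algebraMap ℂ B r) b)
      have h2 := mk_rel (NCPolyRel.scalar (B := B) (I := I) r)
      rw [map_mul, h2, AlgHom.commutes, ← Algebra.smul_def, ← Algebra.smul_def] at h1
      simpa using h1)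

/-- The indeterminate `X i`. -/
def X (i : I) : NCPoly B I := mk (FreeAlgebra.ι ℂ (Sum.inr i))

variable {R : Type*} [Ring R] [Algebra ℂ R]

/-- The homomorphism `b ↦ φ b`, `X i ↦ Y i`. -/
def lift (φ : B →ₐ[ℂ] R) (Y : I → R) : NCPoly B I →ₐ[ℂ] R :=
  RingQuot.liftAlgHom ℂ
    ⟨FreeAlgebra.lift ℂ (Sum.elim φ Y), by
      intro x y h
      induction h <;> simp⟩

@[simp] theorem lift_C (φ : B →ₐ[ℂ] R) (Y : I → R) (b : B) : lift φ Y (C b) = φ b := by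
  change RingQuot.liftAlgHom ℂ _ (RingQuot.mkAlgHom ℂ _ _) = _
  rw [RingQuot.liftAlgHom_mkAlgHom_apply]
  simp

@[simp] theorem lift_X (φ : B →ₐ[ℂ] R) (Y : I → R) (i : I) : lift φ Y (X i) = Y i := by
  change RingQuot.liftAlgHom ℂ _ (RingQuot.mkAlgHom ℂ _ _) = _
  rw [RingQuot.liftAlgHom_mkAlgHom_apply]
  simp

theorem hom_ext {f g : NCPoly B I →ₐ[ℂ] R} (hC : ∀ b, f (C b) = g (C b))
    (hX : ∀ i, f (X i) = g (X i)) : f = g := by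
  apply RingQuot.ringQuot_ext'
  apply FreeAlgebra.hom_ext
  funext s
  cases s with
  | inl b => exact hC b
  | inr i => exact hX i

theorem induction_on {p : NCPoly B I → Prop} (P : NCPoly B I) (hC : ∀ b, p (C b))
    (hX : ∀ i, p (X i)) (hadd : ∀ P Q, p P → p Q → p (P + Q))
    (hmul : ∀ P Q, p P → p Q → p (P * Q)) : p P := by
  obtain ⟨x, rfl⟩ := RingQuot.mkAlgHom_surjective ℂ (NCPolyRel B I) P
  change p (mk x)
  induction x using FreeAlgebra.induction with
  | grade0 r =>
    have h := hC (algebraMap ℂ B r)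
    rwa [AlgHom.commutes, ← AlgHom.commutes mk] at h
  | grade1 s =>
    cases s with
    | inl b => exact hC b
    | inr i => exact hX i
  | mul x y hx hy => rw [map_mul]; exact hmul _ _ hx hy
  | add x y hx hy => rw [map_add]; exact hadd _ _ hx hy

end NCPoly

end NCPoly

/-! ### Free difference quotients -/

section FreeDifferenceQuotient

variable {B : Type*} [Ring B] [Algebra ℂ B] {I : Type*} [DecidableEq I]

/-- The homomorphism `P ↦ !![P ⊗ 1, ∂ⱼ P; 0, 1 ⊗ P]`, whose corner defines `∂ⱼ`. -/
def diffQuotHom (j : I) :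
    NCPoly B I →ₐ[ℂ] Matrix (Fin 2) (Fin 2) (NCPoly B I ⊗[ℂ] NCPoly B I) :=
  NCPoly.lift
    (AlgHom.mk'
      { toFun := fun b => !![(NCPoly.C b) ⊗ₜ[ℂ] 1, 0; 0, 1 ⊗ₜ[ℂ] (NCPoly.C b)]
        map_one' := by
          simp [Matrix.one_fin_two, Algebra.TensorProduct.one_def]
        map_mul' := fun b c => by simp
        map_zero' := by
          ext i k; fin_cases i <;> fin_cases k <;> simp
        map_add' := fun b c => by
          ext i k; fin_cases i <;> fin_cases k <;>
            simp [TensorProduct.add_tmul, TensorProduct.tmul_add] }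
      (fun r b => by
        ext i k; fin_cases i <;> fin_cases k <;> simp [TensorProduct.smul_tmul']))
    (fun i => !![(NCPoly.X i) ⊗ₜ[ℂ] 1, if i = j then 1 else 0; 0, 1 ⊗ₜ[ℂ] (NCPoly.X i)])

/-- The free difference quotient
`∂ⱼ : B⟨X i : i ∈ I⟩ → B⟨X i : i ∈ I⟩ ⊗ B⟨X i : i ∈ I⟩`: the derivation (see `diffQuot_mul`) that
vanishes on `B` and maps `X i` to `δᵢⱼ 1 ⊗ 1`. -/
def diffQuot (j : I) : NCPoly B I →ₗ[ℂ] NCPoly B I ⊗[ℂ] NCPoly B I where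
  toFun P := diffQuotHom j P 0 1
  map_add' P Q := by simp
  map_smul' r P := by simp

theorem diffQuot_C (j : I) (b : B) : diffQuot j (NCPoly.C b) = 0 := by
  simp [diffQuot, diffQuotHom]

theorem diffQuot_X (j i : I) :
    diffQuot j (NCPoly.X i : NCPoly B I) = if i = j then 1 ⊗ₜ[ℂ] 1 else 0 := by
  simp [diffQuot, diffQuotHom, Algebra.TensorProduct.one_def]

theorem diffQuotHom_diag (j : I) (P : NCPoly B I) :
    diffQuotHom j P 0 0 = P ⊗ₜ[ℂ] 1 ∧ diffQuotHom j P 1 0 = 0 ∧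
      diffQuotHom j P 1 1 = 1 ⊗ₜ[ℂ] P := by
  induction P using NCPoly.induction_on with
  | hC b => simp [diffQuotHom]
  | hX i => simp [diffQuotHom]
  | hadd P Q hP hQ =>
    simp [hP, hQ, TensorProduct.add_tmul, TensorProduct.tmul_add]
  | hmul P Q hP hQ =>
    simp [Matrix.mul_apply, Fin.sum_univ_two, hP, hQ]

theorem diffQuot_mul (j : I) (P Q : NCPoly B I) :
    diffQuot j (P * Q) =
      (P ⊗ₜ[ℂ] 1) * diffQuot j Q + diffQuot j P * ((1 : NCPoly B I) ⊗ₜ[ℂ] Q) := by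
  simp [diffQuot, Matrix.mul_apply, Fin.sum_univ_two, diffQuotHom_diag]

end FreeDifferenceQuotient

/-! ### Tracial operator-valued probability spaces -/

/-- A tracial `B`-valued `C*`-probability space `(A, B, τ, E)`: a unital inclusion `incl : B → A` of
unital `C*`-algebras, a faithful tracial state `τ` on `A` and a positive, `τ`-preserving
conditional expectation `E : A → B`. -/
structure TracialSpace (A B : Type*) [CStarAlgebra A] [CStarAlgebra B] [PartialOrder B]
    [StarOrderedRing B] where
  incl : B →⋆ₐ[ℂ] A
  incl_injective : Function.Injective incl
  E : A →ₗ[ℂ] B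
  E_incl (b : B) : E (incl b) = b
  E_bimodule (b c : B) (a : A) : E (incl b * a * incl c) = b * E a * c
  E_nonneg (a : A) : 0 ≤ E (star a * a)
  τ : A →ₗ[ℂ] ℂ
  τ_one : τ 1 = 1
  τ_nonneg (a : A) : 0 ≤ (τ (star a * a)).re ∧ (τ (star a * a)).im = 0
  τ_tracial (a a' : A) : τ (a * a') = τ (a' * a)
  τ_faithful (a : A) : τ (star a * a) = 0 → a = 0
  τ_E (a : A) : τ (incl (E a)) = τ a

section Probability

variable {A B : Type*} [CStarAlgebra A] [CStarAlgebra B] [PartialOrder B] [StarOrderedRing B]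

/-- The evaluation homomorphism `P ↦ P(Y)` on `B⟨X i : i ∈ I⟩`. -/
def ev (V : TracialSpace A B) {I : Type*} (Y : I → A) : NCPoly B I →ₐ[ℂ] A :=
  NCPoly.lift V.incl.toAlgHom Y

/-- The squared norm `‖a‖²_τ = τ(a* a)`. -/
def normSqTau (V : TracialSpace A B) (a : A) : ℝ := (V.τ (star a * a)).re

/-- The bilinear form on `A ⊗ A` with
`(a₁ ⊗ a₂, a₃ ⊗ a₄) ↦ τ(a₂ η(E[a₁ a₃]) a₄)`. -/
def etaBilin (V : TracialSpace A B) (η : B →ₗ[ℂ] B) :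
    A ⊗[ℂ] A →ₗ[ℂ] A ⊗[ℂ] A →ₗ[ℂ] ℂ :=
  TensorProduct.lift <| LinearMap.mk₂ ℂ
    (fun a₁ a₂ => TensorProduct.lift <| LinearMap.mk₂ ℂ
      (fun a₃ a₄ => V.τ (a₂ * V.incl (η (V.E (a₁ * a₃))) * a₄))
      (by intros; simp [mul_add, add_mul]) (by intros; simp)
      (by intros; simp [mul_add]) (by intros; simp))
    (by intros; ext; simp [mul_add, add_mul]) (by intros; ext; simp)
    (by intros; ext; simp [add_mul]) (by intros; ext; simp)

/-- The pre-inner product `⟨ξ, ξ'⟩_η` on the algebraic tensor product `A ⊗ A` over `ℂ`, conjugate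
linear in `ξ` (see `etaInner_tmul`). -/
def etaInner (V : TracialSpace A B) (η : B →ₗ[ℂ] B) (ξ ξ' : A ⊗[ℂ] A) : ℂ :=
  etaBilin V η (star ξ) ξ'

theorem etaInner_tmul (V : TracialSpace A B) (η : B →ₗ[ℂ] B) (a₁ a₂ a₃ a₄ : A) :
    etaInner V η (a₁ ⊗ₜ[ℂ] a₂) (a₃ ⊗ₜ[ℂ] a₄) =
      V.τ (star a₂ * V.incl (η (V.E (star a₁ * a₃))) * a₄) := by
  simp [etaInner, etaBilin]

/-- The squared seminorm `‖ξ‖²_η = ⟨ξ, ξ⟩_η`. -/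
def normSqEta (V : TracialSpace A B) (η : B →ₗ[ℂ] B) (ξ : A ⊗[ℂ] A) : ℝ :=
  (etaInner V η ξ ξ).re

/-! ### Freeness and semicircular systems -/

/-- `B`-free independence of `Y 1, …, Y d`: every alternating product
`(P₁(Y i₁) - E[P₁(Y i₁)]) ⋯ (Pₖ(Y iₖ) - E[Pₖ(Y iₖ)])`, with `k ≥ 1` and `Pₘ ∈ B⟨X⟩`, has
expectation zero. The list `w` is `(i₁, P₁), …, (iₖ, Pₖ)`. -/
def BFree (V : TracialSpace A B) {d : ℕ} (Y : Fin d → A) : Prop :=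
  ∀ w : List (Fin d × NCPoly B Unit), w ≠ [] → (w.map Prod.fst).IsChain (· ≠ ·) →
    V.E (w.map fun q => ev V (fun _ => Y q.1) q.2
      - V.incl (V.E (ev V (fun _ => Y q.1) q.2))).prod = 0

/-- The non-crossing pair partitions of `k` points, a pair partition being given by the
fixed-point-free involution that exchanges the two points of every block. -/
def NC2 (k : ℕ) : Finset (Fin k → Fin k) :=
  open Classical in
  Finset.univ.filter fun σ =>
    (∀ p, σ (σ p) = p) ∧ (∀ p, σ p ≠ p) ∧ ∀ p q, p < q → q < σ p → ¬ σ p < σ q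

/-- The contribution of the block structure `σ` to the expectation of the word
`b p, s, b (p + 1), s, …, s, b q` whose letters `s` carry the numbers `p, …, q - 1`. If `p` and
`r = σ p` form a block, then the block contributes `b p * η (inside) * outside`, where the inside
is the word with letters `p + 1, …, r - 1` and the outside is the word with letters
`r + 1, …, q - 1`. -/
def nestedValue (η : B →ₗ[ℂ] B) (b : ℕ → B) (σ : ℕ → ℕ) (p q : ℕ) : B :=
  if p < σ p ∧ σ p < q then
    b p * η (nestedValue η b σ (p + 1) (σ p)) * nestedValue η b σ (σ p + 1) q
  else b p
termination_by q - p

/-- `b₀ η_π(b₁, …, bₖ₋₁) bₖ` for a non-crossing pair partition `π` of `k` points, where `η_π` is the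
multiplicative functional determined by `η`. -/
def multValue (η : B →ₗ[ℂ] B) {k : ℕ} (π : Fin k → Fin k) (b : ℕ → B) : B :=
  nestedValue η b (fun p => if h : p < k then (π ⟨p, h⟩ : ℕ) else p) 0 k

/-- `s` is a `B`-valued semicircular element with mean `0` and variance `η`: it is self-adjoint and
`E[b₀ s b₁ ⋯ s bₖ] = ∑_{π ∈ NC₂(k)} b₀ η_π(b₁, …, bₖ₋₁) bₖ`. -/
def IsSemicircular (V : TracialSpace A B) (η : B →CP B) (s : A) : Prop :=
  IsSelfAdjoint s ∧ ∀ (k : ℕ) (b : ℕ → B),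
    V.E (V.incl (b 0) * ((List.range k).map fun m => s * V.incl (b (m + 1))).prod) =
      ∑ π ∈ NC2 k, multValue η.toLinearMap π b

/-- `S 1, …, S d` is a `B`-free `B`-valued semicircular system associated with `η 1, …, η d`. -/
def IsSemicircularSystem (V : TracialSpace A B) {d : ℕ} (η : Fin d → (B →CP B)) (S : Fin d → A) :
    Prop :=
  BFree V S ∧ ∀ j, IsSemicircular V (η j) (S j)

end Probability

/-! ### The `B`-valued Chebyshev family -/

section Chebyshev

variable {B : Type*} [Ring B] [Algebra ℂ B] {I : Type*}

/-- The element `Uₙ^η(b₁, b₁'; …; bₙ, bₙ')(X i)`, for the list `(b₁, b₁'), …, (bₙ, bₙ')`, of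
the `B`-valued Chebyshev family associated with `η`, with `U₀ = 1`. -/
def chebyshev (η : B →ₗ[ℂ] B) (i : I) : List (B × B) → NCPoly B I
  | [] => 1
  | [q] => NCPoly.C q.1 * NCPoly.X i * NCPoly.C q.2
  | q :: r :: l => NCPoly.C q.1 * NCPoly.X i * NCPoly.C q.2 * chebyshev η i (r :: l)
      - NCPoly.C (q.1 * η (q.2 * r.1) * r.2) * chebyshev η i l

/-- A term is a list `(i₁, c₁), …, (iₗ, cₗ)`, each `cₜ` being a list of `nₜ` pairs of elements of
`B`. It stands for the product of the `U_{nₜ}^{η_{iₜ}}(cₜ)(X iₜ)`. -/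
def termValue {d : ℕ} (η : Fin d → (B →ₗ[ℂ] B)) (t : List (Fin d × List (B × B))) :
    NCPoly B (Fin d) :=
  (t.map fun q => chebyshev (η q.1) q.1 q.2).prod

/-- The terms that may occur: `ℓ ≥ 1`, consecutive `iₜ` are distinct, and all `nₜ ≥ 1`. -/
def IsChebyshevTerm {d : ℕ} (t : List (Fin d × List (B × B))) : Prop :=
  t ≠ [] ∧ (t.map Prod.fst).IsChain (· ≠ ·) ∧ ∀ q ∈ t, q.2 ≠ []

/-- The shape `(i₁, n₁), …, (iₗ, nₗ)` of a term. -/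
def termShape {d : ℕ} (t : List (Fin d × List (B × B))) : List (Fin d × ℕ) :=
  t.map fun q => (q.1, q.2.length)

/-- The class `𝒯_η B⟨X 1, …, X d⟩`: the sums of an element of `B` and of finitely many Chebyshev
terms in which every shape occurs at most once. -/
def chebyshevClass {d : ℕ} (η : Fin d → (B →ₗ[ℂ] B)) : Set (NCPoly B (Fin d)) :=
  {P | ∃ (b : B) (F : List (List (Fin d × List (B × B)))),
    (∀ t ∈ F, IsChebyshevTerm t) ∧ (F.map termShape).Nodup ∧
      P = NCPoly.C b + (F.map (termValue η)).sum}

end Chebyshev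

/-- The free Poincaré inequality
`‖P(S) - E[P(S)]‖²_τ ≤ ∑ⱼ ‖ev_S^{⊗2}(∂ⱼ P)‖²_{ηⱼ}` for the polynomial `P`. -/
def PoincareInequality {A B : Type*} [CStarAlgebra A] [CStarAlgebra B] [PartialOrder B]
    [StarOrderedRing B] (V : TracialSpace A B) {d : ℕ} (η : Fin d → (B →CP B)) (S : Fin d → A)
    (P : NCPoly B (Fin d)) : Prop :=
  normSqTau V (ev V S P - V.incl (V.E (ev V S P))) ≤
    ∑ j, normSqEta V (η j).toLinearMap
      (Algebra.TensorProduct.map (ev V S) (ev V S) (diffQuot j P))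

end BValued

end

/-! The model is the full Fock space, on which `X j` acts as creation plus annihilation. The Wick
polynomials `wick η b l` are the polynomials that would correspond to elementary tensors there:
multiplying one by `X j` prepends a letter and adds one contraction (`C_mul_X_mul_wick`). They span
all polynomials, they factor at every change of index into one-variable pieces, and those pieces are
Chebyshev elements (`wick_eq_chebyshev`).

The pivot is that a self-adjoint `s` is semicircular exactly when its Wick polynomials of positive
length have expectation zero (`isSemicircular_iff_wick`). Both conditions are equivalent to the
Schwinger–Dyson equation: sorting non-crossing pairings by the partner of the first point gives it
for moments, and deconcatenation of words under `∂` gives it for Wick polynomials.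

From semicircularity to the inequality: freeness extends the centring to mixed words
(`E_wick_eq_zero`), so Wick polynomials have the inner products of the Fock space
(`E_star_wick_mul_wick`) and different lengths are orthogonal. The sum of the `∂ⱼ* ∂ⱼ` acts as the
number operator (`sum_etaInner_diffQuot_wick`). With `Pₙ` the part of length `n`, the two sides are
`∑_{n ≥ 1} ‖Pₙ‖²` and `∑ n ‖Pₙ‖²`.

From the inequality on the Chebyshev class back to semicircularity: words of length one give
equality, so the difference of the two sides is a quadratic form that vanishes at `X j e`. Its
nonnegativity at the perturbations of `X j e` by multiples of a longer one-variable Wick polynomial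
`W` forces the mixed term to vanish (`poincareForm_eq_zero`). By induction on the length the
derivative part of that term is zero, which leaves `τ(e* E[S j W]) = 0`. Taking `e = E[S j W]` and
using faithfulness gives `e = 0`, and the Wick recursion then centres the next length
(`E_wick_eq_zero_of_poincare`). -/

namespace BValued

/-! ### Wick polynomials -/

section Splits

variable {I B : Type*}

/-- The ways to write the list `(j₁, c₁), …, (jₙ, cₙ)` as a prefix, an element `(j, c)` and a
suffix. -/
def splits : List (I × B) → List ((I × List (I × B)) × B × List (I × B))
  | [] => []
  | q :: l => ((q.1, []), q.2, l) :: (splits l).map fun x => ((x.1.1, q :: x.1.2), x.2)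

theorem length_of_mem_splits {l : List (I × B)} {x : (I × List (I × B)) × B × List (I × B)}
    (hx : x ∈ splits l) : x.1.2.length + x.2.2.length + 1 = l.length := by
  induction l generalizing x with
  | nil => simp [splits] at hx
  | cons q l ih =>
    simp only [splits, List.mem_cons, List.mem_map] at hx
    rcases hx with rfl | ⟨y, hy, rfl⟩
    · simp
    · have := ih hy
      simp only [List.length_cons]
      omega

theorem subset_of_mem_splits {l : List (I × B)} {x : (I × List (I × B)) × B × List (I × B)}
    (hx : x ∈ splits l) : x.1.2 ⊆ l ∧ x.2.2 ⊆ l := by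
  induction l generalizing x with
  | nil => simp [splits] at hx
  | cons q l ih =>
    simp only [splits, List.mem_cons, List.mem_map] at hx
    rcases hx with rfl | ⟨y, hy, rfl⟩
    · simp
    · exact ⟨List.cons_subset_cons _ (ih hy).1, List.subset_cons_of_subset _ (ih hy).2⟩

end Splits

section Wick

variable {B : Type*} [Ring B] [Algebra ℂ B] {I : Type*} [DecidableEq I]

open NCPoly

/-- The `B`-valued Wick polynomial of the word `b X j₁ c₁ X j₂ c₂ ⋯ X jₙ cₙ`, which is given by `b`
and the list `(j₁, c₁), …, (jₙ, cₙ)`. It is the product of the Chebyshev elements that belong to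
the maximal blocks of constant index. -/
def wick (η : I → B →ₗ[ℂ] B) : B → List (I × B) → NCPoly B I
  | b, [] => C b
  | b, [q] => C b * X q.1 * C q.2
  | b, q :: r :: l => C b * X q.1 * wick η q.2 (r :: l)
      - if r.1 = q.1 then wick η (b * η q.1 q.2 * r.2) l else 0

/-- The contraction of the first two letters of the word `b X j c ⋯`. -/
def contraction (η : I → B →ₗ[ℂ] B) (b : B) (q : I × B) : List (I × B) → NCPoly B I
  | [] => 0
  | r :: l => if r.1 = q.1 then wick η (b * η q.1 q.2 * r.2) l else 0

theorem wick_cons (η : I → B →ₗ[ℂ] B) (b : B) (q : I × B) (l : List (I × B)) :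
    wick η b (q :: l) = C b * X q.1 * wick η q.2 l - contraction η b q l := by
  cases l <;> simp [wick, contraction]

theorem C_mul_wick (η : I → B →ₗ[ℂ] B) (a b : B) (l : List (I × B)) :
    C a * wick η b l = wick η (a * b) l := by
  match l with
  | [] => simp [wick]
  | [q] => simp [wick, mul_assoc]
  | q :: r :: l =>
    have h := C_mul_wick η a (b * η q.1 q.2 * r.2) l
    simp only [mul_assoc] at h
    simp only [wick, mul_sub, map_mul, mul_ite, mul_zero, h, mul_assoc]

theorem C_mul_contraction (η : I → B →ₗ[ℂ] B) (a b : B) (q : I × B) (l : List (I × B)) :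
    C a * contraction η b q l = contraction η (a * b) q l := by
  cases l <;> simp [contraction, C_mul_wick, mul_assoc, mul_ite]

theorem wick_smul (η : I → B →ₗ[ℂ] B) (r : ℂ) (b : B) (l : List (I × B)) :
    wick η (r • b) l = r • wick η b l := by
  have h := C_mul_wick η (algebraMap ℂ B r) b l
  rw [AlgHom.commutes, ← Algebra.smul_def, ← Algebra.smul_def] at h
  exact h.symm

/-- `X j` acts on Wick polynomials as the sum of a creation and an annihilation operator. -/
theorem C_mul_X_mul_wick (η : I → B →ₗ[ℂ] B) (a b : B) (j : I) (l : List (I × B)) :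
    C a * X j * wick η b l = wick η a ((j, b) :: l) + contraction η a (j, b) l := by
  simp [wick_cons]

/-- A Wick polynomial factors wherever the index changes. -/
theorem wick_append (η : I → B →ₗ[ℂ] B) (b : B) (p : List (I × B)) (j : I) (c : B) (q : I × B)
    (l : List (I × B)) (h : q.1 ≠ j) :
    wick η b (p ++ (j, c) :: q :: l) = wick η b (p ++ [(j, 1)]) * wick η c (q :: l) := by
  match p with
  | [] => simp [wick, h]
  | [r] =>
    by_cases hr : j = r.1
    · simp [wick, hr ▸ h, hr, sub_mul, mul_assoc, C_mul_wick]
    · simp [wick, h, hr, mul_assoc]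
  | r :: s :: p =>
    have h1 := wick_append η r.2 (s :: p) j c q l h
    have h2 := wick_append η (b * η r.1 r.2 * s.2) p j c q l h
    simp only [List.cons_append, mul_assoc] at h1 h2 ⊢
    simp only [wick, h1, h2, sub_mul, mul_assoc, ite_mul, zero_mul]

/-- Every polynomial is a finite sum of Wick polynomials. -/
theorem exists_eq_sum_wick (η : I → B →ₗ[ℂ] B) (P : NCPoly B I) :
    ∃ L : List (B × List (I × B)), P = (L.map fun x => wick η x.1 x.2).sum := by
  -- Left multiplication by `P` preserves the span of the Wick polynomials; in this form the
  -- induction on `P` passes through products.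
  suffices h : ∀ Q : NCPoly B I, (∃ L : List (B × List (I × B)),
      Q = (L.map fun x => wick η x.1 x.2).sum) → ∃ L : List (B × List (I × B)),
      P * Q = (L.map fun x => wick η x.1 x.2).sum by
    simpa using h 1 ⟨[(1, [])], by simp [wick]⟩
  induction P using NCPoly.induction_on with
  | hC a =>
    rintro Q ⟨L, rfl⟩
    refine ⟨L.map fun x => (a * x.1, x.2), ?_⟩
    simp [List.sum_map_mul_left, Function.comp_def, ← C_mul_wick]
  | hX j =>
    rintro Q ⟨L, rfl⟩
    induction L with
    | nil => exact ⟨[], by simp⟩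
    | cons x L ih =>
      obtain ⟨L', h⟩ := ih
      have h1 := C_mul_X_mul_wick η 1 x.1 j x.2
      -- A contraction is again one Wick polynomial; when it vanishes, coefficient `0` with the
      -- empty word represents it.
      obtain ⟨y, hy⟩ : ∃ y : B × List (I × B), contraction η 1 (j, x.1) x.2 = wick η y.1 y.2 := by
        match x.2 with
        | [] => exact ⟨(0, []), by simp [contraction, wick]⟩
        | r :: l =>
          by_cases hr : r.1 = j
          · exact ⟨(1 * η j x.1 * r.2, l), by simp [contraction, hr]⟩
          · exact ⟨(0, []), by simp [contraction, wick, hr]⟩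
      refine ⟨(1, (j, x.1) :: x.2) :: y :: L', ?_⟩
      rw [map_one, one_mul, hy] at h1
      simp [mul_add, h, h1, add_assoc]
  | hadd P P' hP hP' =>
    intro Q hQ
    obtain ⟨L, h⟩ := hP Q hQ
    obtain ⟨L', h'⟩ := hP' Q hQ
    exact ⟨L ++ L', by simp [add_mul, h, h']⟩
  | hmul P P' hP hP' =>
    intro Q hQ
    rw [mul_assoc]
    exact hP _ (hP' Q hQ)

theorem linearMap_ext_wick (η : I → B →ₗ[ℂ] B) {M : Type*} [AddCommGroup M] [Module ℂ M]
    {f g : NCPoly B I →ₗ[ℂ] M} (h : ∀ b l, f (wick η b l) = g (wick η b l)) : f = g := by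
  ext P
  obtain ⟨L, rfl⟩ := exists_eq_sum_wick η P
  simp [map_list_sum, Function.comp_def, h]

/-- The summand of the free difference quotient of a Wick polynomial that belongs to a split. -/
def splitTensor (η : I → B →ₗ[ℂ] B) (j : I) (b : B) (x : (I × List (I × B)) × B × List (I × B)) :
    NCPoly B I ⊗[ℂ] NCPoly B I :=
  if x.1.1 = j then wick η b x.1.2 ⊗ₜ wick η x.2.1 x.2.2 else 0

/-- The correction terms match: differentiating the contraction of the first two letters contracts
the left tensor legs, which is exactly what turns `b X ·` applied to these legs into Wick
polynomials. Hence `∂ⱼ` is deconcatenation at the letters `j`, with no contraction terms left over.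
-/
theorem diffQuot_wick (η : I → B →ₗ[ℂ] B) (j : I) (b : B) (l : List (I × B)) :
    diffQuot j (wick η b l) = ((splits l).map (splitTensor η j b)).sum := by
  have key : ∀ (q : I × B) (l : List (I × B)),
      diffQuot j (wick η q.2 l) = ((splits l).map (splitTensor η j q.2)).sum →
      diffQuot j (contraction η b q l) = ((splits l).map fun x =>
        if x.1.1 = j then contraction η b q x.1.2 ⊗ₜ wick η x.2.1 x.2.2 else 0).sum →
      diffQuot j (wick η b (q :: l)) = ((splits (q :: l)).map (splitTensor η j b)).sum := by
    intro q l h1 h2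
    rw [wick_cons, map_sub, h2, diffQuot_mul, h1, diffQuot_mul, diffQuot_C, diffQuot_X]
    simp only [splits, List.map_cons, List.sum_cons, List.map_map, Function.comp_def]
    -- The Wick recursion applied to the left leg of every split that lies beyond the letter `q`.
    have h3 : ((splits l).map fun x => splitTensor η j b ((x.1.1, q :: x.1.2), x.2)).sum
        + ((splits l).map fun x =>
          if x.1.1 = j then contraction η b q x.1.2 ⊗ₜ[ℂ] wick η x.2.1 x.2.2 else 0).sum =
        ((C b * X q.1) ⊗ₜ[ℂ] (1 : NCPoly B I)) * ((splits l).map (splitTensor η j q.2)).sum := by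
      rw [← List.sum_map_mul_left, ← List.sum_map_add]
      congr 1
      refine List.map_congr_left fun x _ => ?_
      by_cases hx : x.1.1 = j
      · simp [splitTensor, hx, wick_cons, TensorProduct.sub_tmul]
      · simp [splitTensor, hx]
    rw [eq_sub_iff_add_eq.mpr h3]
    by_cases hq : q.1 = j
    · simp [splitTensor, hq, wick]
      abel
    · simp [splitTensor, hq]
  match l with
  | [] => simp [wick, splits, diffQuot_C]
  | [q] =>
    refine key q [] ?_ ?_
    · simp [wick, splits, diffQuot_C]
    · simp [contraction, splits]
  | q :: r :: l =>
    refine key q (r :: l) (diffQuot_wick η j q.2 (r :: l)) ?_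
    -- The split at `r` has an empty left leg, whose contraction is `0`; the other splits are those
    -- of the word after `r`.
    by_cases hr : r.1 = q.1
    · simp only [contraction, hr, if_true, splits, List.map_cons, List.sum_cons, List.map_map,
        Function.comp_def, TensorProduct.zero_tmul, ite_self, zero_add]
      rw [diffQuot_wick η j _ l]
      rfl
    · simp [contraction, hr, splits, Function.comp_def]
termination_by l.length

end Wick

/-! ### Symmetry of the functionals -/

/-- Polarisation: the squares of `a + 1` and `a + i` show that `f(a*) + f(a)` and `i(f(a*) - f(a))`
are self-adjoint, and the two facts together determine `f(a*)`. -/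
theorem map_star_of_isSelfAdjoint {A M : Type*} [Ring A] [StarRing A] [Algebra ℂ A]
    [StarModule ℂ A] [AddCommGroup M] [Module ℂ M] [StarAddMonoid M] [StarModule ℂ M]
    (f : A →ₗ[ℂ] M) (hf : ∀ a, IsSelfAdjoint (f (star a * a))) (a : A) :
    f (star a) = star (f a) := by
  have h0 := (hf a).star_eq
  have h1 := (hf 1).star_eq
  have h2 := (hf (a + 1)).star_eq
  have h3 := (hf (a + algebraMap ℂ A Complex.I)).star_eq
  have e2 : star (a + 1) * (a + 1) = star a * a + star a + a + star 1 * 1 := by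
    simp [add_mul, mul_add]; abel
  have e3 : star (a + algebraMap ℂ A Complex.I) * (a + algebraMap ℂ A Complex.I) =
      star a * a + Complex.I • star a - Complex.I • a + star 1 * 1 := by
    simp [Algebra.algebraMap_eq_smul_one, add_mul, mul_add, smul_smul]
    abel
  rw [e2] at h2
  rw [e3] at h3
  simp only [map_add, map_sub, star_add, star_sub, h0, h1, map_smul, star_smul,
    Complex.star_def, Complex.conj_I, add_left_inj] at h2 h3
  have h4 : Complex.I • (star (f a) - star (f (star a))) = Complex.I • (f (star a) - f a) := by
    linear_combination (norm := module) h3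
  have h5 := smul_right_injective M Complex.I_ne_zero h4
  linear_combination (norm := module) (-1 / 2 : ℂ) • h2 - (1 / 2 : ℂ) • h5

namespace TracialSpace

variable {A B : Type*} [CStarAlgebra A] [CStarAlgebra B] [PartialOrder B] [StarOrderedRing B]
  (V : TracialSpace A B)

theorem E_star (a : A) : V.E (star a) = star (V.E a) :=
  map_star_of_isSelfAdjoint V.E (fun a => IsSelfAdjoint.of_nonneg (V.E_nonneg a)) a

theorem τ_star (a : A) : V.τ (star a) = star (V.τ a) :=
  map_star_of_isSelfAdjoint V.τ
    (fun a => Complex.conj_eq_iff_im.mpr (V.τ_nonneg a).2) a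

theorem E_incl_mul (b : B) (a : A) : V.E (V.incl b * a) = b * V.E a := by
  simpa using V.E_bimodule b 1 a

theorem E_mul_incl (a : A) (b : B) : V.E (a * V.incl b) = V.E a * b := by
  simpa using V.E_bimodule 1 b a

end TracialSpace

section Inner

variable {A B : Type*} [CStarAlgebra A] [CStarAlgebra B] [PartialOrder B] [StarOrderedRing B]
  (V : TracialSpace A B) (η : B →ₗ[ℂ] B)

theorem etaInner_add_left (ξ ξ' ζ : A ⊗[ℂ] A) :
    etaInner V η (ξ + ξ') ζ = etaInner V η ξ ζ + etaInner V η ξ' ζ := by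
  simp [etaInner]

theorem etaInner_add_right (ξ ζ ζ' : A ⊗[ℂ] A) :
    etaInner V η ξ (ζ + ζ') = etaInner V η ξ ζ + etaInner V η ξ ζ' := by
  simp [etaInner]

theorem etaInner_zero_left (ζ : A ⊗[ℂ] A) : etaInner V η 0 ζ = 0 := by
  simp [etaInner]

theorem etaInner_zero_right (ξ : A ⊗[ℂ] A) : etaInner V η ξ 0 = 0 := by
  simp [etaInner]

theorem etaInner_smul_right (r : ℂ) (ξ ζ : A ⊗[ℂ] A) :
    etaInner V η ξ (r • ζ) = r * etaInner V η ξ ζ := by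
  simp [etaInner]

theorem etaInner_list_sum_left (L : List (A ⊗[ℂ] A)) (ζ : A ⊗[ℂ] A) :
    etaInner V η L.sum ζ = (L.map fun ξ => etaInner V η ξ ζ).sum := by
  induction L with
  | nil => simp [etaInner_zero_left]
  | cons ξ L ih => simp [etaInner_add_left, ih]

theorem etaInner_list_sum_right (ξ : A ⊗[ℂ] A) (L : List (A ⊗[ℂ] A)) :
    etaInner V η ξ L.sum = (L.map fun ζ => etaInner V η ξ ζ).sum := by
  induction L with
  | nil => simp [etaInner_zero_right]
  | cons ζ L ih => simp [etaInner_add_right, ih]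

theorem etaInner_finset_sum_left {ι : Type*} (s : Finset ι) (f : ι → A ⊗[ℂ] A) (ζ : A ⊗[ℂ] A) :
    etaInner V η (∑ i ∈ s, f i) ζ = ∑ i ∈ s, etaInner V η (f i) ζ := by
  simp [etaInner, star_sum]

theorem etaInner_finset_sum_right {ι : Type*} (s : Finset ι) (f : ι → A ⊗[ℂ] A)
    (ξ : A ⊗[ℂ] A) :
    etaInner V η ξ (∑ i ∈ s, f i) = ∑ i ∈ s, etaInner V η ξ (f i) := by
  simp [etaInner]

theorem star_etaInner (hη : ∀ b, η (star b) = star (η b)) (ξ ζ : A ⊗[ℂ] A) :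
    star (etaInner V η ξ ζ) = etaInner V η ζ ξ := by
  induction ξ using TensorProduct.induction_on with
  | zero => simp [etaInner_zero_left, etaInner_zero_right]
  | add ξ ξ' h h' => rw [etaInner_add_left, etaInner_add_right, star_add, h, h']
  | tmul a a' =>
    induction ζ using TensorProduct.induction_on with
    | zero => simp [etaInner_zero_left, etaInner_zero_right]
    | add ξ ξ' h h' => rw [etaInner_add_left, etaInner_add_right, star_add, h, h']
    | tmul c c' =>
      simp [etaInner_tmul, ← V.τ_star, ← map_star, ← hη, ← V.E_star, mul_assoc]

end Inner

/-! ### Wick polynomials of a free family -/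

section FreeWick

variable {A B : Type*} [CStarAlgebra A] [CStarAlgebra B] [PartialOrder B] [StarOrderedRing B]
  (V : TracialSpace A B)

theorem ev_C {I : Type*} (Y : I → A) (b : B) : ev V Y (NCPoly.C b) = V.incl b := by
  simp [ev]

theorem ev_X {I : Type*} (Y : I → A) (i : I) : ev V Y (NCPoly.X i) = Y i := by
  simp [ev]

/-- Freeness and semicircularity speak of polynomials in one indeterminate, indexed by `Unit`; this
moves them to words of constant index in all indeterminates. Injectivity keeps the contraction tests
`r.1 = q.1` unchanged. -/
theorem ev_wick_reindex {I J : Type*} [DecidableEq I] [DecidableEq J] (f : J → I)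
    (hf : Function.Injective f) (η : I → B →ₗ[ℂ] B) (S : I → A) (b : B) (l : List (J × B)) :
    ev V S (wick η b (l.map fun q => (f q.1, q.2))) =
      ev V (fun j => S (f j)) (wick (fun j => η (f j)) b l) := by
  match l with
  | [] => simp [wick, ev_C]
  | [q] => simp [wick, ev_C, ev_X]
  | q :: r :: l =>
    have h1 := ev_wick_reindex f hf η S q.2 (r :: l)
    have h2 := ev_wick_reindex f hf η S (b * η (f q.1) q.2 * r.2) l
    simp only [List.map_cons] at h1 ⊢
    by_cases h : r.1 = q.1
    · rw [h] at h1
      simp [wick, ev_C, ev_X, h1, h2, h]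
    · simp [wick, ev_C, ev_X, h1, h, hf.eq_iff]

/-- The expectation of every nontrivial Wick polynomial in a single variable vanishes. -/
def CentredWick {d : ℕ} (η : Fin d → B →ₗ[ℂ] B) (S : Fin d → A) : Prop :=
  ∀ (j : Fin d) (b : B) (m : List (Unit × B)), m ≠ [] →
    V.E (ev V (fun _ => S j) (wick (fun _ => η j) b m)) = 0

/-- The word is read from the left while `m` stores the current run of index `j`. At a change of
index the Wick polynomial splits off the finished run, a one-variable Wick polynomial, which equals
its own centring by `h`. The result is an alternating product to which freeness applies. -/
theorem exists_alternating_factorization {d : ℕ} {η : Fin d → B →ₗ[ℂ] B} {S : Fin d → A}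
    (h : CentredWick V η S) (l : List (Fin d × B)) (j : Fin d) (c : B) (m : List (Unit × B))
    (b : B) :
    ∃ (P : NCPoly B Unit) (w : List (Fin d × NCPoly B Unit)),
      (((j, P) :: w).map Prod.fst).IsChain (· ≠ ·) ∧
      ev V S (wick η b (m.map (fun q => (j, q.2)) ++ (j, c) :: l)) =
        (((j, P) :: w).map fun q => ev V (fun _ => S q.1) q.2
          - V.incl (V.E (ev V (fun _ => S q.1) q.2))).prod := by
  have single : ∀ (m : List (Unit × B)) (c b : B),
      ev V (fun _ => S j) (wick (fun _ => η j) b (m ++ [((), c)])) =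
        ev V S (wick η b (m.map (fun q => (j, q.2)) ++ [(j, c)])) := by
    intro m c b
    have h1 := ev_wick_reindex V (fun _ : Unit => j) (fun _ _ _ => rfl) η S b (m ++ [((), c)])
    simpa using h1.symm
  induction l generalizing j c m b with
  | nil =>
    refine ⟨wick (fun _ => η j) b (m ++ [((), c)]), [], by simp, ?_⟩
    have h1 := h j b (m ++ [((), c)]) (by simp)
    rw [single] at h1
    simp [h1, single]
  | cons q l ih =>
    by_cases hq : q.1 = j
    · have h1 := ih j q.2 (m ++ [((), c)]) b single
      simpa [← hq] using h1
    · obtain ⟨P, w, hw, hp⟩ := ih q.1 q.2 [] c (by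
        intro m c b
        have h1 := ev_wick_reindex V (fun _ : Unit => q.1) (fun _ _ _ => rfl) η S b
          (m ++ [((), c)])
        simpa using h1.symm)
      -- The finished run ends with coefficient `1`, because `c` becomes the leading coefficient of
      -- the next run.
      refine ⟨wick (fun _ => η j) b (m ++ [((), 1)]), (q.1, P) :: w, ?_, ?_⟩
      · simp only [List.map_cons, List.isChain_cons_cons] at hw ⊢
        exact ⟨Ne.symm hq, hw⟩
      · rw [wick_append _ _ _ _ _ _ _ hq, map_mul, List.map_cons, List.prod_cons, ← hp,
          h j b (m ++ [((), 1)]) (by simp), single]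
        simp

theorem E_wick_eq_zero {d : ℕ} {η : Fin d → B →ₗ[ℂ] B} {S : Fin d → A} (hS : BFree V S)
    (h : CentredWick V η S) (b : B) (l : List (Fin d × B)) (hl : l ≠ []) :
    V.E (ev V S (wick η b l)) = 0 := by
  match l with
  | (j, c) :: l =>
    obtain ⟨P, w, hw, hp⟩ := exists_alternating_factorization V h l j c [] b
    have h1 := hS _ (by simp) hw
    rw [← hp] at h1
    simpa using h1

end FreeWick

/-! ### The inner product of Wick polynomials -/

section Pairing

variable {I B : Type*} [DecidableEq I] [Ring B] [StarRing B] [Algebra ℂ B]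

/-- The `B`-valued inner product of two Wick words in the full Fock space. -/
def wickPairing (η : I → B →ₗ[ℂ] B) : B → List (I × B) → B → List (I × B) → B
  | b, [], b', [] => star b * b'
  | b, q :: l, b', q' :: l' =>
    if q.1 = q'.1 then wickPairing η q.2 l (η q.1 (star b * b') * q'.2) l' else 0
  | _, [], _, _ :: _ => 0
  | _, _ :: _, _, [] => 0

theorem wickPairing_zero_right (η : I → B →ₗ[ℂ] B) (b : B) (l l' : List (I × B)) :
    wickPairing η b l 0 l' = 0 := by
  induction l generalizing b l' with
  | nil => cases l' <;> simp [wickPairing]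
  | cons q l ih => cases l' <;> simp [wickPairing, ih]

theorem wickPairing_of_length_ne (η : I → B →ₗ[ℂ] B) (b b' : B) (l l' : List (I × B))
    (h : l.length ≠ l'.length) : wickPairing η b l b' l' = 0 := by
  induction l generalizing b b' l' with
  | nil => cases l' <;> simp_all [wickPairing]
  | cons q l ih =>
    cases l' with
    | nil => simp [wickPairing]
    | cons q' l' => simp [wickPairing, ih _ _ l' (by simpa using h)]

theorem wickPairing_mul_left (η : I → B →ₗ[ℂ] B) (a b b' : B)
    (l l' : List (I × B)) :
    wickPairing η (a * b) l b' l' = wickPairing η b l (star a * b') l' := by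
  cases l <;> cases l' <;> simp [wickPairing, mul_assoc]

/-- Splits at different positions have left legs of different lengths and contribute zero. Splits at
the same position reassemble the whole pairing, once per letter, which is the source of the factor
`l.length`. -/
theorem sum_splits_wickPairing (η : I → B →ₗ[ℂ] B) (b b' : B) (l l' : List (I × B)) :
    ((splits l).map fun x => ((splits l').map fun y =>
      if x.1.1 = y.1.1 then
        wickPairing η x.2.1 x.2.2 (η x.1.1 (wickPairing η b x.1.2 b' y.1.2) * y.2.1) y.2.2
      else 0).sum).sum = l.length • wickPairing η b l b' l' := by
  induction l generalizing b b' l' with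
  | nil => simp [splits]
  | cons q l ih =>
    cases l' with
    | nil => simp [splits, wickPairing, Function.comp_def]
    | cons q' l' =>
      by_cases hq : q.1 = q'.1
      · have h := ih q.2 (η q'.1 (star b * b') * q'.2) l'
        simp [splits, wickPairing, Function.comp_def, hq, wickPairing_zero_right, h,
          add_mul, add_comm]
      · simp [splits, wickPairing, Function.comp_def, hq, wickPairing_zero_right]

end Pairing

/-! ### The number operator and the Poincaré inequality -/

section Poincare

variable {A B : Type*} [CStarAlgebra A] [CStarAlgebra B] [PartialOrder B] [StarOrderedRing B]
  (V : TracialSpace A B)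

/-- The first letter of the left word is moved to the right factor by self-adjointness, where it
creates or annihilates. The creation term cancels against the contraction in the Wick recursion of
the left word; the annihilation term is the recursion of `wickPairing`. Centring enters only when
the left word is empty. -/
theorem E_star_wick_mul_wick {I : Type*} [DecidableEq I] {η : I → B →ₗ[ℂ] B} {S : I → A}
    (hη : ∀ j b, η j (star b) = star (η j b)) (hS : ∀ j, IsSelfAdjoint (S j))
    (h0 : ∀ b l, l ≠ [] → V.E (ev V S (wick η b l)) = 0) (b b' : B) (l l' : List (I × B)) :
    V.E (star (ev V S (wick η b l)) * ev V S (wick η b' l')) = wickPairing η b l b' l' := by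
  have nil_case : ∀ b b' l', V.E (star (ev V S (wick η b [])) * ev V S (wick η b' l')) =
      wickPairing η b [] b' l' := by
    intro b b' l'
    rw [wick, ev_C, ← map_star, ← ev_C V S, ← map_mul, C_mul_wick]
    cases l' with
    | nil => simp [wick, wickPairing, ev_C, V.E_incl, V.E_incl_mul]
    | cons q l' => rw [h0 _ _ (by simp), wickPairing]
  have step : ∀ q m, (∀ b' l', V.E (star (ev V S (wick η q.2 m)) * ev V S (wick η b' l')) =
        wickPairing η q.2 m b' l') →
      V.E (star (ev V S (contraction η b q m)) * ev V S (wick η b' l')) =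
        wickPairing η q.2 m 1 ((q.1, star b * b') :: l') →
      V.E (star (ev V S (wick η b (q :: m))) * ev V S (wick η b' l')) =
        wickPairing η b (q :: m) b' l' := by
    intro q m h1 h2
    have h3 : S q.1 * V.incl (star b) * ev V S (wick η b' l') =
        ev V S (wick η 1 ((q.1, star b * b') :: l'))
          + ev V S (contraction η 1 (q.1, star b * b') l') := by
      rw [← map_add, ← C_mul_X_mul_wick]
      simp [ev_C, ev_X, ← C_mul_wick, mul_assoc]
    have h4 : V.E (star (ev V S (wick η q.2 m)) * ev V S (contraction η 1 (q.1, star b * b') l')) =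
        wickPairing η b (q :: m) b' l' := by
      cases l' with
      | nil => simp [contraction, wickPairing]
      | cons r l' =>
        by_cases hr : q.1 = r.1
        · simp [contraction, wickPairing, hr, h1]
        · simp [contraction, wickPairing, hr, Ne.symm hr]
    rw [wick_cons, map_sub, star_sub, sub_mul, map_sub, h2, map_mul (ev V S), map_mul (ev V S),
      ev_C, ev_X, star_mul, star_mul, (hS q.1).star_eq, mul_assoc, ← map_star V.incl, h3, mul_add, map_add, h1, h4]
    abel
  match l with
  | [] => exact nil_case b b' l'
  | [q] => exact step q [] (nil_case q.2) (by simp [contraction, wickPairing])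
  | q :: r :: l =>
    refine step q (r :: l) (fun b' l' => E_star_wick_mul_wick hη hS h0 q.2 b' (r :: l) l') ?_
    by_cases hr : r.1 = q.1
    · simp only [contraction, wickPairing, hr, if_true, mul_one]
      rw [E_star_wick_mul_wick hη hS h0 _ b' l l', wickPairing_mul_left, star_mul, hη, mul_assoc]
    · simp [contraction, wickPairing, hr]
termination_by l.length

theorem sum_list_map_sum_comm {ι α M : Type*} [AddCommMonoid M] (s : Finset ι) (L : List α)
    (f : ι → α → M) : ∑ i ∈ s, (L.map (f i)).sum = (L.map fun x => ∑ i ∈ s, f i x).sum := by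
  induction L with
  | nil => simp
  | cons x L ih => simp [Finset.sum_add_distrib, ih]

/-- `∑ⱼ ∂ⱼ* ∂ⱼ` acts on Wick polynomials as the number operator. -/
theorem sum_etaInner_diffQuot_wick {d : ℕ} {η : Fin d → B →ₗ[ℂ] B} {S : Fin d → A}
    (hη : ∀ j b, η j (star b) = star (η j b)) (hS : ∀ j, IsSelfAdjoint (S j))
    (h0 : ∀ b l, l ≠ [] → V.E (ev V S (wick η b l)) = 0) (b b' : B) (l l' : List (Fin d × B)) :
    ∑ j, etaInner V (η j)
      (Algebra.TensorProduct.map (ev V S) (ev V S) (diffQuot j (wick η b l)))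
      (Algebra.TensorProduct.map (ev V S) (ev V S) (diffQuot j (wick η b' l'))) =
    l.length * V.τ (star (ev V S (wick η b l)) * ev V S (wick η b' l')) := by
  -- The left legs pair to an element of `B`, on which `η j` acts; the result is absorbed into the
  -- leading coefficient of the second right leg, and then the right legs are paired.
  have h1 : ∀ j x y, etaInner V (η j)
      (Algebra.TensorProduct.map (ev V S) (ev V S) (splitTensor η j b x))
      (Algebra.TensorProduct.map (ev V S) (ev V S) (splitTensor η j b' y)) =
      if x.1.1 = j then if x.1.1 = y.1.1 then V.τ (V.incl
        (wickPairing η x.2.1 x.2.2 (η x.1.1 (wickPairing η b x.1.2 b' y.1.2) * y.2.1) y.2.2))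
      else 0 else 0 := by
    intro j x y
    by_cases hx : x.1.1 = j
    · by_cases hy : x.1.1 = y.1.1
      · subst hx
        simp only [splitTensor, ← hy, if_true, Algebra.TensorProduct.map_tmul, etaInner_tmul]
        rw [E_star_wick_mul_wick V hη hS h0, mul_assoc, ← ev_C V S, ← map_mul, C_mul_wick,
          ← V.τ_E, E_star_wick_mul_wick V hη hS h0]
      · have hy' : y.1.1 ≠ j := fun h => hy (hx.trans h.symm)
        simp [splitTensor, hx, hy', hx ▸ hy, etaInner_zero_right]
    · simp [splitTensor, hx, etaInner_zero_left]
  rw [← V.τ_E, E_star_wick_mul_wick V hη hS h0, ← nsmul_eq_mul, ← map_nsmul, ← map_nsmul,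
    ← sum_splits_wickPairing]
  simp only [diffQuot_wick, map_list_sum, List.map_map, Function.comp_def,
    etaInner_list_sum_left]
  simp only [etaInner_list_sum_right, List.map_map, Function.comp_def, h1]
  rw [sum_list_map_sum_comm]
  congr 1
  refine List.map_congr_left fun x _ => ?_
  rw [sum_list_map_sum_comm]
  congr 1
  refine List.map_congr_left fun y _ => ?_
  rw [Finset.sum_ite_eq]
  split_ifs <;> simp_all

theorem normSqTau_nonneg (a : A) : 0 ≤ normSqTau V a := (V.τ_nonneg a).1

/-- The free Poincaré inequality holds as soon as nontrivial Wick polynomials are centred. -/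
theorem poincareInequality_of_E_wick {d : ℕ} {η : Fin d → (B →CP B)} {S : Fin d → A}
    (hη : ∀ j b, η j (star b) = star (η j b)) (hS : ∀ j, IsSelfAdjoint (S j))
    (h0 : ∀ b l, l ≠ [] → V.E (ev V S (wick (fun j => (η j).toLinearMap) b l)) = 0)
    (P : NCPoly B (Fin d)) : PoincareInequality V η S P := by
  set η' : Fin d → B →ₗ[ℂ] B := fun j => (η j).toLinearMap with hη'
  obtain ⟨L, hL⟩ := exists_eq_sum_wick η' P
  let b : Fin L.length → B := fun i => (L.get i).1
  let l : Fin L.length → List (Fin d × B) := fun i => (L.get i).2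
  have hP : P = ∑ i, wick η' (b i) (l i) := hL.trans (Fin.sum_univ_fun_getElem L _).symm
  let W : Fin L.length → A := fun i => ev V S (wick η' (b i) (l i))
  let K : Fin L.length → Fin L.length → ℂ := fun i i' => V.τ (star (W i) * W i')
  have hK : ∀ i i', (l i).length ≠ (l i').length → K i i' = 0 := by
    intro i i' h
    simp only [K, W]
    rw [← V.τ_E, E_star_wick_mul_wick V hη hS h0, wickPairing_of_length_ne _ _ _ _ _ h]
    simp
  have hKs : ∀ s t : Finset (Fin L.length),
      V.τ (star (∑ i ∈ s, W i) * ∑ i ∈ t, W i) = ∑ i ∈ s, ∑ i' ∈ t, K i i' := by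
    intro s t
    simp [K, star_sum, Finset.sum_mul_sum]
  let N : Finset ℕ := Finset.univ.image fun i => (l i).length
  let T : ℕ → Finset (Fin L.length) := fun n => Finset.univ.filter fun i => (l i).length = n
  -- By orthogonality of different lengths, a weight depending on the length acts on each
  -- homogeneous component separately. The right side of the inequality has weight `n`, the left
  -- side weight `0` at `n = 0` and `1` elsewhere.
  have grade : ∀ g : ℕ → ℝ, (∑ i, ∑ i', (g (l i).length : ℂ) * K i i').re =
      ∑ n ∈ N, g n * normSqTau V (∑ i ∈ T n, W i) := by
    intro g
    rw [← Finset.sum_fiberwise_of_maps_to (g := fun i => (l i).length) (t := N)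
      (fun i _ => Finset.mem_image_of_mem _ (Finset.mem_univ i)), Complex.re_sum]
    refine Finset.sum_congr rfl fun n _ => ?_
    rw [normSqTau, hKs, ← Complex.re_ofReal_mul, Finset.mul_sum]
    congr 1
    refine Finset.sum_congr rfl fun i hi => ?_
    have hi' : (l i).length = n := (Finset.mem_filter.mp hi).2
    rw [hi', ← Finset.mul_sum]
    congr 1
    refine (Finset.sum_subset (Finset.subset_univ _) fun i' _ h => hK i i' fun h' => h ?_).symm
    simp [T, ← h', hi']
  have right : ∑ j, normSqEta V (η j).toLinearMap
      (Algebra.TensorProduct.map (ev V S) (ev V S) (diffQuot j P)) =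
      ∑ n ∈ N, (n : ℝ) * normSqTau V (∑ i ∈ T n, W i) := by
    rw [← grade fun n => n]
    simp only [normSqEta]
    rw [← Complex.re_sum]
    congr 1
    simp only [hP, map_sum, etaInner_finset_sum_left]
    simp only [etaInner_finset_sum_right]
    rw [Finset.sum_comm]
    refine Finset.sum_congr rfl fun i _ => ?_
    rw [Finset.sum_comm]
    refine Finset.sum_congr rfl fun i' _ => ?_
    exact sum_etaInner_diffQuot_wick V hη hS h0 (b i) (b i') (l i) (l i')
  have hE : ev V S P - V.incl (V.E (ev V S P)) =
      ∑ i ∈ Finset.univ.filter (fun i => (l i).length ≠ 0), W i := by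
    rw [hP, map_sum, map_sum, map_sum, ← Finset.sum_sub_distrib, Finset.sum_filter]
    refine Finset.sum_congr rfl fun i _ => ?_
    by_cases h : l i = []
    · simp [h, wick, ev_C, V.E_incl]
    · simp [h, h0 _ _ h, W]
  have left : normSqTau V (ev V S P - V.incl (V.E (ev V S P))) =
      ∑ n ∈ N, (if n = 0 then 0 else 1 : ℝ) * normSqTau V (∑ i ∈ T n, W i) := by
    rw [← grade, hE, normSqTau, hKs, Finset.sum_filter]
    congr 1
    refine Finset.sum_congr rfl fun i _ => ?_
    by_cases h : (l i).length = 0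
    · simp [h]
    · rw [if_pos h, if_neg h, Complex.ofReal_one, Finset.sum_filter]
      refine Finset.sum_congr rfl fun i' _ => ?_
      by_cases h' : (l i').length = 0
      · rw [hK i i' (by rwa [h'])]
        simp
      · simp [h']
  unfold PoincareInequality
  rw [left, right]
  refine Finset.sum_le_sum fun n _ => mul_le_mul_of_nonneg_right ?_ (normSqTau_nonneg V _)
  split_ifs with h
  · simp
  · exact_mod_cast Nat.one_le_iff_ne_zero.mpr h

end Poincare

/-! ### Recursion for sums over non-crossing pair partitions -/

section NonCrossing

/-- The involutions of `ℕ` whose restriction to `[p, q)` is a non-crossing pair partition and which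
are the identity elsewhere. -/
structure IsNCPairing (p q : ℕ) (σ : ℕ → ℕ) : Prop where
  invol : ∀ x, σ (σ x) = x
  eq_self : ∀ x, x < p ∨ q ≤ x → σ x = x
  ne_self : ∀ x, p ≤ x → x < q → σ x ≠ x
  nonCrossing : ∀ x y, x < y → y < σ x → ¬ σ x < σ y

namespace IsNCPairing

variable {p q : ℕ} {σ : ℕ → ℕ}

theorem mapsTo (h : IsNCPairing p q σ) {x : ℕ} (h1 : p ≤ x) (h2 : x < q) :
    p ≤ σ x ∧ σ x < q := by
  by_contra hx
  have h3 := h.eq_self (σ x) (by omega)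
  rw [h.invol] at h3
  exact h.ne_self x h1 h2 h3.symm

theorem lt_apply (h : IsNCPairing p q σ) (hpq : p < q) : p < σ p ∧ σ p < q := by
  have h1 := h.mapsTo le_rfl hpq
  have h2 := h.ne_self p le_rfl hpq
  omega

theorem eq_id (h : IsNCPairing p q σ) (hpq : q ≤ p) : σ = id :=
  funext fun x => h.eq_self x (by omega)

theorem id_of_le (hpq : q ≤ p) : IsNCPairing p q id :=
  ⟨fun _ => rfl, fun _ _ => rfl, fun x h1 h2 => by omega, fun x y h1 h2 => by simp at h2; omega⟩

/-- A partner beyond `σ p` would cross the block of `p`, and the two endpoints of that block are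
already taken. -/
theorem inside (h : IsNCPairing p q σ) (hpq : p < q) {x : ℕ} (h1 : p < x) (h2 : x < σ p) :
    p < σ x ∧ σ x < σ p := by
  have h3 := h.lt_apply hpq
  have h4 := h.mapsTo h1.le (h2.trans h3.2)
  have h5 := h.nonCrossing p x h1 h2
  have h6 : σ x ≠ σ p := fun e => by
    have := congrArg σ e
    rw [h.invol, h.invol] at this
    omega
  have h7 : σ x ≠ p := fun e => by
    have := congrArg σ e
    rw [h.invol] at this
    omega
  omega

theorem outside (h : IsNCPairing p q σ) (hpq : p < q) {x : ℕ} (h1 : σ p < x) (h2 : x < q) :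
    σ p < σ x ∧ σ x < q := by
  have h3 := h.lt_apply hpq
  have h4 := h.mapsTo (h3.1.trans h1).le h2
  have h6 : σ x ≠ σ p := fun e => by
    have := congrArg σ e
    rw [h.invol, h.invol] at this
    omega
  have h7 : σ x ≠ p := fun e => by
    have := congrArg σ e
    rw [h.invol] at this
    omega
  have h8 : ¬ (p < σ x ∧ σ x < σ p) := fun e => by
    have := h.inside hpq e.1 e.2
    rw [h.invol] at this
    omega
  omega

end IsNCPairing

/-- The pair partition that consists of the block `{p, r}`, of the blocks of `σ` inside and of
the blocks of `ρ` to the right. -/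
def gluePairing (p r : ℕ) (σ ρ : ℕ → ℕ) (x : ℕ) : ℕ :=
  if x = p then r else if x = r then p else if x < r then σ x else ρ x

theorem IsNCPairing.glue {p r q : ℕ} {σ ρ : ℕ → ℕ} (hpr : p < r) (hrq : r < q)
    (hσ : IsNCPairing (p + 1) r σ) (hρ : IsNCPairing (r + 1) q ρ) :
    IsNCPairing p q (gluePairing p r σ ρ) := by
  have inP : gluePairing p r σ ρ p = r := by simp [gluePairing]
  have inR : gluePairing p r σ ρ r = p := by simp [gluePairing, hpr.ne']
  have inI : ∀ x, p < x → x < r → gluePairing p r σ ρ x = σ x := fun x h1 h2 => by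
    simp [gluePairing, h1.ne', h2.ne, h2]
  have inO : ∀ x, r < x → gluePairing p r σ ρ x = ρ x := fun x h1 => by
    simp [gluePairing, (hpr.trans h1).ne', h1.ne', h1.not_gt]
  have inL : ∀ x, x < p → gluePairing p r σ ρ x = x := fun x h1 => by
    simp [gluePairing, h1.ne, (h1.trans hpr).ne, h1.trans hpr, hσ.eq_self x (by omega)]
  have σI : ∀ x, p < x → x < r → p < σ x ∧ σ x < r := fun x h1 h2 => hσ.mapsTo h1 h2
  have ρO : ∀ x, r < x → r < ρ x ∧ (x < q → ρ x < q) := fun x h1 => by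
    by_cases h : x < q
    · exact ⟨(hρ.mapsTo h1 h).1, fun _ => (hρ.mapsTo h1 h).2⟩
    · rw [hρ.eq_self x (by omega)]
      exact ⟨h1, id⟩
  have cases5 : ∀ x, x < p ∨ x = p ∨ (p < x ∧ x < r) ∨ x = r ∨ r < x := fun x => by omega
  refine ⟨fun x => ?_, fun x hx => ?_, fun x h1 h2 => ?_, fun x y h1 h2 => ?_⟩
  · rcases cases5 x with h | rfl | h | rfl | h
    · rw [inL x h, inL x h]
    · rw [inP, inR]
    · rw [inI x h.1 h.2, inI _ (σI x h.1 h.2).1 (σI x h.1 h.2).2, hσ.invol]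
    · rw [inR, inP]
    · rw [inO x h, inO _ (ρO x h).1, hρ.invol]
  · rcases hx with hx | hx
    · exact inL x hx
    · rw [inO x (by omega), hρ.eq_self x (by omega)]
  · rcases cases5 x with h | rfl | h | rfl | h
    · omega
    · rw [inP]; omega
    · rw [inI x h.1 h.2]; exact hσ.ne_self x h.1 h.2
    · rw [inR]; omega
    · rw [inO x h]; exact hρ.ne_self x h h2
  · rcases cases5 x with h | rfl | h | rfl | h
    · rw [inL x h] at h2; omega
    · rw [inP] at h2 ⊢
      rw [inI y h1 h2]
      have := σI y h1 h2
      omega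
    · rw [inI x h.1 h.2] at h2 ⊢
      have h3 := σI x h.1 h.2
      rw [inI y (by omega) (by omega)]
      exact hσ.nonCrossing x y h1 h2
    · rw [inR] at h2; omega
    · rw [inO x h] at h2 ⊢
      rw [inO y (by omega)]
      exact hρ.nonCrossing x y h1 h2

/-- The restriction of a map to `[p, q)`, extended by the identity. -/
def restrictPairing (p q : ℕ) (σ : ℕ → ℕ) (x : ℕ) : ℕ := if p ≤ x ∧ x < q then σ x else x

theorem IsNCPairing.restrict {p q p' q' : ℕ} {σ : ℕ → ℕ} (h : IsNCPairing p q σ) (hp : p ≤ p')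
    (hq : q' ≤ q) (hm : ∀ x, p' ≤ x → x < q' → p' ≤ σ x ∧ σ x < q') :
    IsNCPairing p' q' (restrictPairing p' q' σ) := by
  have hin : ∀ x, p' ≤ x → x < q' → restrictPairing p' q' σ x = σ x := fun x h1 h2 => by
    simp [restrictPairing, h1, h2]
  have hout : ∀ x, ¬ (p' ≤ x ∧ x < q') → restrictPairing p' q' σ x = x := fun x h1 => by
    simp only [restrictPairing, if_neg h1]
  refine ⟨fun x => ?_, fun x hx => hout x (by omega), fun x h1 h2 => ?_, fun x y h1 h2 => ?_⟩
  · by_cases hx : p' ≤ x ∧ x < q'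
    · have := hm x hx.1 hx.2
      rw [hin x hx.1 hx.2, hin _ this.1 this.2, h.invol]
    · rw [hout x hx, hout x hx]
  · rw [hin x h1 h2]
    exact h.ne_self x (by omega) (by omega)
  · by_cases hx : p' ≤ x ∧ x < q'
    · have := hm x hx.1 hx.2
      rw [hin x hx.1 hx.2] at h2 ⊢
      rw [hin y (by omega) (by omega)]
      exact h.nonCrossing x y h1 h2
    · rw [hout x hx] at h2
      omega

theorem IsNCPairing.glue_restrict {p q : ℕ} {σ : ℕ → ℕ} (h : IsNCPairing p q σ) (hpq : p < q) :
    gluePairing p (σ p) (restrictPairing (p + 1) (σ p) σ) (restrictPairing (σ p + 1) q σ) = σ := by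
  funext x
  have h1 := h.lt_apply hpq
  simp only [gluePairing, restrictPairing]
  split_ifs with h2 h3 h4 h5 h6
  · rw [h2]
  · rw [h3, h.invol]
  · rfl
  · exact (h.eq_self x (by omega)).symm
  · rfl
  · exact (h.eq_self x (by omega)).symm

theorem IsNCPairing.restrict_glue_left {p r : ℕ} {σ : ℕ → ℕ} (ρ : ℕ → ℕ)
    (hσ : IsNCPairing (p + 1) r σ) :
    restrictPairing (p + 1) r (gluePairing p r σ ρ) = σ := by
  funext x
  simp only [gluePairing, restrictPairing]
  split_ifs with h1 h2 h3 h4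
  any_goals omega
  exact (hσ.eq_self x (by omega)).symm

theorem IsNCPairing.restrict_glue_right {p r q : ℕ} {ρ : ℕ → ℕ} (σ : ℕ → ℕ) (hpr : p < r)
    (hρ : IsNCPairing (r + 1) q ρ) :
    restrictPairing (r + 1) q (gluePairing p r σ ρ) = ρ := by
  funext x
  simp only [gluePairing, restrictPairing]
  split_ifs with h1 h2 h3 h4
  any_goals omega
  exact (hρ.eq_self x (by omega)).symm

theorem finite_isNCPairing (p q : ℕ) : {σ | IsNCPairing p q σ}.Finite := by
  refine (Set.finite_range fun (f : Fin q → Fin q) (x : ℕ) =>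
    if h : x < q then (f ⟨x, h⟩ : ℕ) else x).subset ?_
  intro σ (h : IsNCPairing p q σ)
  have h1 : ∀ x, x < q → σ x < q := fun x hx => by
    by_cases hp : p ≤ x
    · exact (h.mapsTo hp hx).2
    · rwa [h.eq_self x (by omega)]
  refine ⟨fun x => ⟨σ x, h1 x x.2⟩, funext fun x => ?_⟩
  by_cases hx : x < q
  · simp [hx]
  · simp [hx, h.eq_self x (by omega)]

/-- The set of non-crossing pair partitions of `[p, q)`. -/
noncomputable def ncPairings (p q : ℕ) : Finset (ℕ → ℕ) := (finite_isNCPairing p q).toFinset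

theorem mem_ncPairings {p q : ℕ} {σ : ℕ → ℕ} : σ ∈ ncPairings p q ↔ IsNCPairing p q σ := by
  simp [ncPairings]

/-- Summation over non-crossing pair partitions according to the block of the first point. -/
theorem sum_ncPairings {M : Type*} [AddCommMonoid M] {p q : ℕ} (hpq : p < q) (f : (ℕ → ℕ) → M) :
    ∑ σ ∈ ncPairings p q, f σ = ∑ r ∈ Finset.Ioo p q, ∑ σ ∈ ncPairings (p + 1) r,
      ∑ ρ ∈ ncPairings (r + 1) q, f (gluePairing p r σ ρ) := by
  rw [← Finset.sum_fiberwise_of_maps_to (g := fun σ : ℕ → ℕ => σ p) (t := Finset.Ioo p q)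
    (fun σ hσ => Finset.mem_Ioo.mpr ((mem_ncPairings.mp hσ).lt_apply hpq))]
  refine Finset.sum_congr rfl fun r hr => ?_
  rw [Finset.mem_Ioo] at hr
  rw [← Finset.sum_product']
  refine Finset.sum_bij'
    (fun σ _ => (restrictPairing (p + 1) r σ, restrictPairing (r + 1) q σ))
    (fun x _ => gluePairing p r x.1 x.2) ?_ ?_ ?_ ?_ ?_
  · intro σ hσ
    obtain ⟨hm, rfl⟩ := Finset.mem_filter.mp hσ
    have h := mem_ncPairings.mp hm
    rw [Finset.mem_product, mem_ncPairings, mem_ncPairings]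
    exact ⟨h.restrict (by omega) hr.2.le fun x h1 h2 => h.inside hpq h1 h2,
      h.restrict (by omega) le_rfl fun x h1 h2 => h.outside hpq h1 h2⟩
  · intro x hx
    rw [Finset.mem_product, mem_ncPairings, mem_ncPairings] at hx
    rw [Finset.mem_filter, mem_ncPairings]
    exact ⟨hx.1.glue hr.1 hr.2 hx.2, by simp [gluePairing]⟩
  · intro σ hσ
    obtain ⟨hm, rfl⟩ := Finset.mem_filter.mp hσ
    exact (mem_ncPairings.mp hm).glue_restrict hpq
  · intro x hx
    rw [Finset.mem_product, mem_ncPairings, mem_ncPairings] at hx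
    exact Prod.ext (hx.1.restrict_glue_left _) (hx.2.restrict_glue_right _ hr.1)
  · intro σ hσ
    obtain ⟨hm, rfl⟩ := Finset.mem_filter.mp hσ
    rw [(mem_ncPairings.mp hm).glue_restrict hpq]

/-- Extension by the identity puts the pairings of all subintervals into the single type `ℕ → ℕ`,
where restricting and gluing need no renumbering of points. -/
theorem sum_NC2 {M : Type*} [AddCommMonoid M] (k : ℕ) (f : (ℕ → ℕ) → M) :
    ∑ π ∈ NC2 k, f (fun p => if h : p < k then (π ⟨p, h⟩ : ℕ) else p) =
      ∑ σ ∈ ncPairings 0 k, f σ := by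
  have hlt : ∀ σ ∈ ncPairings 0 k, ∀ x : Fin k, σ x < k := fun σ hσ x =>
    ((mem_ncPairings.mp hσ).mapsTo (Nat.zero_le _) x.2).2
  refine Finset.sum_bij' (fun π _ p => if h : p < k then (π ⟨p, h⟩ : ℕ) else p)
    (fun σ hσ x => ⟨σ x, hlt σ hσ x⟩) ?_ ?_ ?_ ?_ ?_
  · intro π hπ
    simp only [NC2, Finset.mem_filter, Finset.mem_univ, true_and] at hπ
    obtain ⟨h1, h2, h3⟩ := hπ
    rw [mem_ncPairings]
    refine ⟨fun x => ?_, fun x hx => ?_, fun x _ hx => ?_, fun x y hxy hyx => ?_⟩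
    · by_cases hx : x < k <;> simp [hx, h1]
    · simp [show ¬ x < k by omega]
    · have := h2 ⟨x, hx⟩
      simpa [hx, Fin.ext_iff] using this
    · by_cases hx : x < k
      · simp only [hx, dif_pos] at hyx ⊢
        have hy : y < k := hyx.trans (π ⟨x, hx⟩).2
        simp only [hy, dif_pos]
        exact h3 ⟨x, hx⟩ ⟨y, hy⟩ hxy hyx
      · simp only [hx, dif_neg, not_false_iff] at hyx
        omega
  · intro σ hσ
    have h := mem_ncPairings.mp hσ
    simp only [NC2, Finset.mem_filter, Finset.mem_univ, true_and]
    refine ⟨fun x => Fin.ext (h.invol x), fun x hx => ?_, fun x y h1 h2 => ?_⟩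
    · exact h.ne_self x (Nat.zero_le _) x.2 (congrArg Fin.val hx)
    · exact h.nonCrossing x y h1 h2
  · intro π _
    funext x
    simp
  · intro σ hσ
    funext x
    by_cases hx : x < k
    · simp [hx]
    · simp [hx, (mem_ncPairings.mp hσ).eq_self x (by omega)]
  · intro π _
    rfl

variable {B : Type*} [CStarAlgebra B]

theorem nestedValue_congr (η : B →ₗ[ℂ] B) (b : ℕ → B) {σ σ' : ℕ → ℕ} {p q : ℕ}
    (h : ∀ x, p ≤ x → x < q → σ x = σ' x) :
    nestedValue η b σ p q = nestedValue η b σ' p q := by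
  rw [nestedValue.eq_def η b σ p q, nestedValue.eq_def η b σ' p q]
  by_cases hpq : p < q
  · rw [← h p le_rfl hpq]
    split_ifs with h1
    · rw [nestedValue_congr η b (p := p + 1) (q := σ p) fun x h2 h3 => h x (by omega) (by omega),
        nestedValue_congr η b (p := σ p + 1) (q := q) fun x h2 h3 => h x (by omega) (by omega)]
    · rfl
  · rw [if_neg (by omega), if_neg (by omega)]
termination_by q - p

/-- The sum of the contributions of all non-crossing pair partitions of `[p, q)`. -/
noncomputable def nestedSum (η : B →ₗ[ℂ] B) (b : ℕ → B) (p q : ℕ) : B :=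
  ∑ σ ∈ ncPairings p q, nestedValue η b σ p q

theorem nestedSum_self (η : B →ₗ[ℂ] B) (b : ℕ → B) (p : ℕ) : nestedSum η b p p = b p := by
  have h : ncPairings p p = {id} := by
    ext σ
    rw [mem_ncPairings, Finset.mem_singleton]
    exact ⟨fun h => h.eq_id le_rfl, fun h => h ▸ IsNCPairing.id_of_le le_rfl⟩
  rw [nestedSum, h, Finset.sum_singleton, nestedValue]
  simp

/-- Once the partner `r` of `p` is fixed, the pairings inside and to the right of the block are
independent and `nestedValue` is multiplicative, so the sum factors. This is the combinatorial form
of the Schwinger–Dyson equation. -/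
theorem nestedSum_of_lt (η : B →ₗ[ℂ] B) (b : ℕ → B) {p q : ℕ} (hpq : p < q) :
    nestedSum η b p q = ∑ r ∈ Finset.Ioo p q,
      b p * η (nestedSum η b (p + 1) r) * nestedSum η b (r + 1) q := by
  rw [nestedSum, sum_ncPairings hpq]
  refine Finset.sum_congr rfl fun r hr => ?_
  rw [Finset.mem_Ioo] at hr
  simp only [nestedSum, map_sum, Finset.mul_sum, Finset.sum_mul]
  rw [Finset.sum_comm]
  refine Finset.sum_congr rfl fun ρ _ => Finset.sum_congr rfl fun σ _ => ?_
  have hp : gluePairing p r σ ρ p = r := by simp [gluePairing]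
  have h1 : nestedValue η b (gluePairing p r σ ρ) (p + 1) r = nestedValue η b σ (p + 1) r :=
    nestedValue_congr η b fun x h1 h2 => by
      rw [gluePairing, if_neg (by omega), if_neg (by omega), if_pos h2]
  have h2 : nestedValue η b (gluePairing p r σ ρ) (r + 1) q = nestedValue η b ρ (r + 1) q :=
    nestedValue_congr η b fun x h1 h2 => by
      rw [gluePairing, if_neg (by omega), if_neg (by omega), if_neg (by omega)]
  rw [nestedValue.eq_def η b _ p q, hp, if_pos hr, h1, h2]

theorem nestedSum_add (η : B →ₗ[ℂ] B) (b : ℕ → B) (s : ℕ) {p q : ℕ} (hpq : p ≤ q) :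
    nestedSum η b (s + p) (s + q) = nestedSum η (fun n => b (s + n)) p q := by
  rcases hpq.eq_or_lt with rfl | hpq
  · rw [nestedSum_self, nestedSum_self]
  · rw [nestedSum_of_lt η b (by omega), nestedSum_of_lt η _ hpq]
    rw [← Finset.map_add_left_Ioo, Finset.sum_map]
    refine Finset.sum_congr rfl fun r hr => ?_
    have hr' := Finset.mem_Ioo.mp hr
    rw [← nestedSum_add η b s (p := p + 1) (q := r) (by omega),
      ← nestedSum_add η b s (p := r + 1) (q := q) (by omega)]
    rfl
termination_by q - p

theorem nestedSum_add_succ (η : B →ₗ[ℂ] B) (b : ℕ → B) (p n : ℕ) :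
    nestedSum η b p (p + (n + 1)) = ∑ i ∈ Finset.range n,
      b p * η (nestedSum η b (p + 1) (p + 1 + i)) *
        nestedSum η b (p + 1 + i + 1) (p + (n + 1)) := by
  rw [nestedSum_of_lt η b (by omega)]
  refine Finset.sum_nbij' (fun r => r - (p + 1)) (fun i => p + 1 + i) ?_ ?_ ?_ ?_ ?_
  · intro r hr
    rw [Finset.mem_Ioo] at hr
    rw [Finset.mem_range]
    omega
  · intro i hi
    rw [Finset.mem_range] at hi
    rw [Finset.mem_Ioo]
    omega
  · intro r hr
    rw [Finset.mem_Ioo] at hr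
    omega
  · intro i _
    omega
  · intro r hr
    rw [Finset.mem_Ioo] at hr
    rw [show p + 1 + (r - (p + 1)) = r by omega]

theorem sum_multValue (η : B →ₗ[ℂ] B) (k : ℕ) (b : ℕ → B) :
    ∑ π ∈ NC2 k, multValue η π b = nestedSum η b 0 k :=
  sum_NC2 k fun σ => nestedValue η b σ 0 k

end NonCrossing

/-! ### Semicircular elements -/

section Words

variable {B : Type*} [Ring B] [Algebra ℂ B]

open NCPoly

/-- The word `b p X b (p + 1) X ⋯ X b (p + n)`. -/
def word (b : ℕ → B) : ℕ → ℕ → NCPoly B Unit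
  | p, 0 => C (b p)
  | p, n + 1 => C (b p) * X () * word b (p + 1) n

theorem word_congr {b b' : ℕ → B} {p : ℕ} (n : ℕ) (h : ∀ x, p ≤ x → b x = b' x) :
    word b p n = word b' p n := by
  induction n generalizing p with
  | zero => simp [word, h p le_rfl]
  | succ n ih => rw [word, word, h p le_rfl, ih fun x hx => h x (by omega)]

theorem word_add (b : ℕ → B) (s p n : ℕ) :
    word b (s + p) n = word (fun m => b (s + m)) p n := by
  induction n generalizing p with
  | zero => rfl
  | succ n ih => rw [word, word, ← ih, add_assoc]

theorem X_mul_word (b : ℕ → B) (n : ℕ) :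
    X () * word b 0 n = word (fun m => if m = 0 then 1 else b (m - 1)) 0 (n + 1) := by
  have h := word_add (fun m => if m = 0 then 1 else b (m - 1)) 1 0 n
  simp only [Nat.add_sub_cancel_left, Nat.add_eq_zero_iff, one_ne_zero, false_and, if_false] at h
  rw [word, show (0 : ℕ) + 1 = 1 + 0 by rfl, h]
  simp

theorem C_mul_word (a : B) (b : ℕ → B) (n : ℕ) :
    C a * word b 0 n = word (fun m => if m = 0 then a * b 0 else b m) 0 n := by
  cases n with
  | zero => simp [word]
  | succ n =>
    rw [word, word, word_congr n (b := b) (b' := fun m => if m = 0 then a * b 0 else b m)]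
    · simp [mul_assoc]
    · intro x hx
      rw [if_neg (by omega)]

theorem exists_eq_sum_word (P : NCPoly B Unit) :
    ∃ L : List ((ℕ → B) × ℕ), P = (L.map fun x => word x.1 0 x.2).sum := by
  suffices h : ∀ Q : NCPoly B Unit, (∃ L : List ((ℕ → B) × ℕ),
      Q = (L.map fun x => word x.1 0 x.2).sum) → ∃ L : List ((ℕ → B) × ℕ),
      P * Q = (L.map fun x => word x.1 0 x.2).sum by
    simpa using h 1 ⟨[(1, 0)], by simp [word]⟩
  induction P using NCPoly.induction_on with
  | hC a =>
    rintro Q ⟨L, rfl⟩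
    refine ⟨L.map fun x => (fun m => if m = 0 then a * x.1 0 else x.1 m, x.2), ?_⟩
    simp [← List.sum_map_mul_left, Function.comp_def, C_mul_word]
  | hX =>
    rintro Q ⟨L, rfl⟩
    refine ⟨L.map fun x => (fun m => if m = 0 then 1 else x.1 (m - 1), x.2 + 1), ?_⟩
    simp [← List.sum_map_mul_left, Function.comp_def, ← X_mul_word]
  | hadd P P' hP hP' =>
    intro Q hQ
    obtain ⟨L, h⟩ := hP Q hQ
    obtain ⟨L', h'⟩ := hP' Q hQ
    exact ⟨L ++ L', by simp [add_mul, h, h']⟩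
  | hmul P P' hP hP' =>
    intro Q hQ
    rw [mul_assoc]
    exact hP _ (hP' Q hQ)

theorem linearMap_ext_word {M : Type*} [AddCommGroup M] [Module ℂ M]
    {f g : NCPoly B Unit →ₗ[ℂ] M} (h : ∀ b n, f (word b 0 n) = g (word b 0 n)) : f = g := by
  ext P
  obtain ⟨L, rfl⟩ := exists_eq_sum_word P
  simp [map_list_sum, Function.comp_def, h]

theorem diffQuot_word (b : ℕ → B) (p n : ℕ) :
    diffQuot () (word b p n) =
      ∑ i ∈ Finset.range n, word b p i ⊗ₜ[ℂ] word b (p + i + 1) (n - 1 - i) := by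
  induction n generalizing p with
  | zero => simp [word, diffQuot_C]
  | succ n ih =>
    rw [word, diffQuot_mul, diffQuot_mul, diffQuot_C, diffQuot_X, ih, Finset.mul_sum,
      Finset.sum_range_succ']
    congr 1
    · refine Finset.sum_congr rfl fun i _ => ?_
      rw [word, show p + (i + 1) + 1 = p + 1 + i + 1 by omega,
        show n + 1 - 1 - (i + 1) = n - 1 - i by omega]
      simp
    · simp [word]

end Words

section Semicircular

variable {A B : Type*} [CStarAlgebra A] [CStarAlgebra B] [PartialOrder B] [StarOrderedRing B]
  (V : TracialSpace A B)

/-- The distribution `P ↦ E[P(s)]` of `s`. -/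
noncomputable def distribution (s : A) : NCPoly B Unit →ₗ[ℂ] B :=
  V.E ∘ₗ (ev V fun _ => s).toLinearMap

/-- The map `P ⊗ Q ↦ η(E[P(s)]) E[Q(s)]`. -/
noncomputable def distributionTensor (η : B →ₗ[ℂ] B) (s : A) :
    NCPoly B Unit ⊗[ℂ] NCPoly B Unit →ₗ[ℂ] B :=
  TensorProduct.lift
    ((LinearMap.mul ℂ B).compl₁₂ (η ∘ₗ distribution V s) (distribution V s))

/-- The Schwinger–Dyson equation `E[s P(s)] = (η ∘ E ⊗ E)[(∂P)(s)]`. -/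
def SchwingerDyson (η : B →ₗ[ℂ] B) (s : A) : Prop :=
  ∀ P, V.E (s * ev V (fun _ => s) P) = distributionTensor V η s (diffQuot () P)

variable {V}

theorem distribution_apply (s : A) (P : NCPoly B Unit) :
    distribution V s P = V.E (ev V (fun _ => s) P) := rfl

theorem distribution_C (s : A) (b : B) : distribution V s (NCPoly.C b) = b := by
  simp [distribution_apply, ev_C, V.E_incl]

theorem distribution_C_mul (s : A) (b : B) (P : NCPoly B Unit) :
    distribution V s (NCPoly.C b * P) = b * distribution V s P := by
  simp [distribution_apply, ev_C, V.E_incl_mul]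

theorem distribution_X_mul (s : A) (P : NCPoly B Unit) :
    distribution V s (NCPoly.X () * P) = V.E (s * ev V (fun _ => s) P) := by
  simp [distribution_apply, ev_X]

theorem distributionTensor_tmul (η : B →ₗ[ℂ] B) (s : A) (P Q : NCPoly B Unit) :
    distributionTensor V η s (P ⊗ₜ Q) = η (distribution V s P) * distribution V s Q := by
  simp [distributionTensor]

theorem ev_word (s : A) (b : ℕ → B) (p n : ℕ) :
    ev V (fun _ => s) (word b p n) =
      V.incl (b p) * ((List.range n).map fun m => s * V.incl (b (p + m + 1))).prod := by
  induction n generalizing p with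
  | zero => simp [word, ev_C]
  | succ n ih =>
    rw [word, map_mul, map_mul, ev_C, ev_X, ih, List.range_succ_eq_map]
    simp [Function.comp_def, mul_assoc, add_assoc, add_comm, add_left_comm]

theorem isSemicircular_iff_distribution (η : B →CP B) {s : A} (hs : IsSelfAdjoint s) :
    IsSemicircular V η s ↔
      ∀ n b, distribution V s (word b 0 n) = nestedSum η.toLinearMap b 0 n := by
  simp only [IsSemicircular, hs, true_and, sum_multValue, distribution_apply, ev_word, zero_add]

/-- The term of `∂` at letter `i` corresponds to pairing the first letter with that letter, so
moments and `nestedSum` obey the same recursion, and it determines them. -/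
theorem SchwingerDyson.distribution_word {η : B →ₗ[ℂ] B} {s : A} (h : SchwingerDyson V η s)
    (b : ℕ → B) (p n : ℕ) : distribution V s (word b p n) = nestedSum η b p (p + n) := by
  induction n using Nat.strong_induction_on generalizing p with
  | _ n ih =>
    cases n with
    | zero => simp [word, distribution_C, nestedSum_self]
    | succ n =>
      rw [word, mul_assoc, distribution_C_mul, distribution_X_mul, h, diffQuot_word, map_sum,
        Finset.mul_sum, nestedSum_add_succ]
      refine Finset.sum_congr rfl fun i hi => ?_
      rw [Finset.mem_range] at hi
      rw [distributionTensor_tmul, ih i (by omega), ih _ (by omega), mul_assoc,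
        show p + 1 + i + 1 + (n - 1 - i) = p + (n + 1) by omega]

theorem schwingerDyson_of_distribution_word {η : B →ₗ[ℂ] B} {s : A}
    (h : ∀ n b, distribution V s (word b 0 n) = nestedSum η b 0 n) : SchwingerDyson V η s := by
  have h' : ∀ b p n, distribution V s (word b p n) = nestedSum η b p (p + n) := by
    intro b p n
    have h1 := word_add b p 0 n
    have h2 := nestedSum_add η b p (Nat.zero_le n)
    rw [add_zero] at h1 h2
    rw [h1, h2, h]
  suffices hfg : distribution V s ∘ₗ LinearMap.mulLeft ℂ (NCPoly.X ()) =
      distributionTensor V η s ∘ₗ diffQuot () by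
    intro P
    rw [← distribution_X_mul]
    exact LinearMap.congr_fun hfg P
  refine linearMap_ext_word fun b n => ?_
  -- Multiplying a word by `X` prepends the coefficient `1` and shifts the others by one place.
  have hshift : ∀ p q, p ≤ q → nestedSum η (fun m => if m = 0 then 1 else b (m - 1))
      (1 + p) (1 + q) = nestedSum η b p q := by
    intro p q hpq
    rw [nestedSum_add η _ 1 hpq]
    simp
  simp only [LinearMap.comp_apply, LinearMap.mulLeft_apply, diffQuot_word, map_sum,
    distributionTensor_tmul]
  rw [X_mul_word, h, show n + 1 = 0 + (n + 1) by omega, nestedSum_add_succ]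
  refine Finset.sum_congr rfl fun i hi => ?_
  rw [Finset.mem_range] at hi
  rw [h', h', show 0 + (n + 1) = 1 + n by omega, show 0 + 1 + i + 1 = 1 + (i + 1) by omega,
    show 0 + 1 + i = 1 + i by omega, show 0 + 1 = 1 + 0 by rfl, hshift 0 i (Nat.zero_le i),
    hshift (i + 1) n hi, show 0 + i + 1 + (n - 1 - i) = n by omega]
  simp

/-- Every split with a nonempty left leg is killed by the centring of that leg; the split at the
first letter gives the annihilation term. Centring is assumed only up to the length of `l`, so that
the lemma can serve inside an induction on length. -/
theorem distributionTensor_diffQuot_wick {η : B →ₗ[ℂ] B} {s : A} (c : B) (l : List (Unit × B))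
    (h : ∀ b m, m ≠ [] → m.length ≤ l.length →
      distribution V s (wick (fun _ => η) b m) = 0) :
    distributionTensor V η s (diffQuot () (wick (fun _ => η) c l)) =
      distribution V s (contraction (fun _ => η) 1 ((), c) l) := by
  rw [diffQuot_wick, map_list_sum]
  cases l with
  | nil => simp [splits, contraction]
  | cons r l =>
    rw [splits, List.map_cons, List.map_cons, List.sum_cons, List.sum_eq_zero]
    · simp [splitTensor, contraction, distributionTensor_tmul, wick, distribution_C,
        ← distribution_C_mul, C_mul_wick]
    · intro x hx
      simp only [List.map_map, List.mem_map, Function.comp_apply] at hx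
      obtain ⟨y, hy, rfl⟩ := hx
      have hl := length_of_mem_splits hy
      have h1 := h c (r :: y.1.2) (by simp) (by simp only [List.length_cons]; omega)
      simp [splitTensor, distributionTensor_tmul, h1]

/-- In the Wick recursion the subtracted contraction is precisely what the Schwinger–Dyson equation
predicts for the expectation of `X` times the tail, given centring in smaller lengths. Conversely
the equation is linear, and it suffices to check it on Wick polynomials. -/
theorem schwingerDyson_iff_wick {η : B →ₗ[ℂ] B} {s : A} : SchwingerDyson V η s ↔
    ∀ b m, m ≠ [] → distribution V s (wick (fun _ => η) b m) = 0 := by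
  constructor
  · intro h b m hm
    induction hn : m.length using Nat.strong_induction_on generalizing b m with
    | _ n ih =>
      match m with
      | q :: m =>
        rw [List.length_cons] at hn
        have h1 := distributionTensor_diffQuot_wick (V := V) (η := η) (s := s) q.2 m
          fun b m' hm' hl => ih m'.length (by omega) b m' hm' rfl
        rw [← h] at h1
        rw [wick_cons, map_sub, mul_assoc, distribution_C_mul, distribution_X_mul, h1,
          ← distribution_C_mul, C_mul_contraction, mul_one, sub_self]
  · intro h
    suffices hfg : distribution V s ∘ₗ LinearMap.mulLeft ℂ (NCPoly.X ()) =
        distributionTensor V η s ∘ₗ diffQuot () by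
      intro P
      rw [← distribution_X_mul]
      exact LinearMap.congr_fun hfg P
    refine linearMap_ext_wick (fun _ => η) fun b l => ?_
    have h1 := C_mul_X_mul_wick (fun _ => η) 1 b () l
    rw [map_one, one_mul] at h1
    simp only [LinearMap.comp_apply, LinearMap.mulLeft_apply]
    rw [h1, map_add, h _ _ (by simp), zero_add,
      distributionTensor_diffQuot_wick b l fun b m hm _ => h b m hm]

/-- An element is semicircular if and only if its nontrivial Wick polynomials are centred. -/
theorem isSemicircular_iff_wick (η : B →CP B) {s : A} (hs : IsSelfAdjoint s) :
    IsSemicircular V η s ↔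
      ∀ (b : B) (m : List (Unit × B)), m ≠ [] →
        V.E (ev V (fun _ => s) (wick (fun _ => η.toLinearMap) b m)) = 0 := by
  rw [isSemicircular_iff_distribution η hs]
  refine ⟨fun h => schwingerDyson_iff_wick.mp (schwingerDyson_of_distribution_word h),
    fun h n b => ?_⟩
  simpa using (schwingerDyson_iff_wick.mpr h).distribution_word b 0 n

end Semicircular

/-! ### The quadratic form of the Poincaré inequality -/

section PoincareForm

variable {A B : Type*} [CStarAlgebra A] [CStarAlgebra B] [PartialOrder B] [StarOrderedRing B]
  (V : TracialSpace A B) {d : ℕ} (η : Fin d → B →ₗ[ℂ] B) (S : Fin d → A)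

/-- The sesquilinear form whose quadratic form is the difference of the two sides of the Poincaré
inequality. -/
noncomputable def poincareForm (P Q : NCPoly B (Fin d)) : ℂ :=
  ∑ j, etaInner V (η j) (Algebra.TensorProduct.map (ev V S) (ev V S) (diffQuot j P))
      (Algebra.TensorProduct.map (ev V S) (ev V S) (diffQuot j Q))
    - V.τ (star (ev V S P - V.incl (V.E (ev V S P))) * (ev V S Q - V.incl (V.E (ev V S Q))))

theorem poincareForm_add_right (P Q R : NCPoly B (Fin d)) :
    poincareForm V η S P (Q + R) = poincareForm V η S P Q + poincareForm V η S P R := by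
  simp only [poincareForm, map_add, etaInner_add_right, Finset.sum_add_distrib, add_sub_add_comm,
    mul_add]

theorem poincareForm_smul_right (r : ℂ) (P Q : NCPoly B (Fin d)) :
    poincareForm V η S P (r • Q) = r * poincareForm V η S P Q := by
  simp only [poincareForm, map_smul, etaInner_smul_right, ← Finset.mul_sum, ← smul_sub,
    mul_smul_comm, smul_eq_mul, mul_sub]

variable {η}

theorem star_poincareForm (hη : ∀ j b, η j (star b) = star (η j b)) (P Q : NCPoly B (Fin d)) :
    star (poincareForm V η S P Q) = poincareForm V η S Q P := by
  simp only [poincareForm, star_sub, star_sum, star_etaInner V _ (hη _), ← V.τ_star, star_mul,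
    star_star]

/-- The Cauchy–Schwarz argument at a null vector: with `r = -t z̄` the form at `P + r Q` is `|z|²
(-2t + t² q)`, which is negative for small `t > 0` unless `z = 0`. Nonnegativity is needed only on
this one family, since the Chebyshev class is not known to be a linear space. -/
theorem poincareForm_eq_zero (hη : ∀ j b, η j (star b) = star (η j b)) {P Q : NCPoly B (Fin d)}
    (hP : poincareForm V η S P P = 0)
    (h : ∀ r : ℂ, 0 ≤ (poincareForm V η S (P + r • Q) (P + r • Q)).re) :
    poincareForm V η S P Q = 0 := by
  set z := poincareForm V η S P Q with hz
  have expand : ∀ r : ℂ, poincareForm V η S (P + r • Q) (P + r • Q) =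
      r * z + star (r * z) + r * star r * poincareForm V η S Q Q := by
    intro r
    rw [poincareForm_add_right, poincareForm_smul_right, ← star_poincareForm V S hη P (P + r • Q),
      ← star_poincareForm V S hη Q (P + r • Q), poincareForm_add_right, poincareForm_smul_right,
      poincareForm_add_right, poincareForm_smul_right, hP, ← hz, ← star_poincareForm V S hη P Q,
      ← hz]
    have hQ := star_poincareForm V S hη Q Q
    simp only [star_add, star_mul', star_star, zero_add] at hQ ⊢
    rw [hQ]
    ring
  set q := (poincareForm V η S Q Q).re with hq
  have key : ∀ t : ℝ, 0 ≤ -2 * t * Complex.normSq z + t ^ 2 * Complex.normSq z * q := by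
    intro t
    have h1 := h (-(t : ℂ) * star z)
    rw [expand] at h1
    have h2 : -(t : ℂ) * star z * z = ((-t * Complex.normSq z : ℝ) : ℂ) := by
      rw [mul_assoc, Complex.star_def, Complex.normSq_eq_conj_mul_self.symm]
      push_cast
      ring
    have h3 : -(t : ℂ) * star z * star (-(t : ℂ) * star z) =
        ((t ^ 2 * Complex.normSq z : ℝ) : ℂ) := by
      rw [star_mul', star_star, star_neg, Complex.star_def, Complex.conj_ofReal,
        show -(t : ℂ) * (starRingEnd ℂ) z * (-(t : ℂ) * z) =
          t ^ 2 * ((starRingEnd ℂ) z * z) by ring,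
        Complex.normSq_eq_conj_mul_self.symm]
      push_cast
      ring
    rw [h2, h3, Complex.star_def, Complex.conj_ofReal, Complex.add_re, Complex.re_ofReal_mul,
      Complex.add_re, Complex.ofReal_re, ← hq] at h1
    linarith
  rw [← Complex.normSq_eq_zero]
  have hn := Complex.normSq_nonneg z
  by_contra hne
  have hpos : 0 < Complex.normSq z := lt_of_le_of_ne hn (Ne.symm hne)
  -- This `t` is small enough whatever the sign of `q`, because `q < 2 (|q| + 1)`.
  have h1 := key (1 / (|q| + 1))
  have h2 : 0 < |q| + 1 := by positivity
  have h3 : q ≤ |q| := le_abs_self q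
  have h4 : -2 * (1 / (|q| + 1)) * Complex.normSq z + (1 / (|q| + 1)) ^ 2 * Complex.normSq z * q =
      (Complex.normSq z / (|q| + 1) ^ 2) * (q - 2 * (|q| + 1)) := by
    field_simp
    ring
  rw [h4] at h1
  have h5 : 0 < Complex.normSq z / (|q| + 1) ^ 2 := by positivity
  have h6 : q - 2 * (|q| + 1) < 0 := by linarith
  exact absurd h1 (not_le.mpr (mul_neg_of_pos_of_neg h5 h6))

theorem poincareInequality_iff (η : Fin d → (B →CP B)) (P : NCPoly B (Fin d)) :
    PoincareInequality V η S P ↔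
      0 ≤ (poincareForm V (fun j => (η j).toLinearMap) S P P).re := by
  simp only [PoincareInequality, poincareForm, normSqTau, normSqEta, Complex.sub_re, Complex.re_sum,
    sub_nonneg]

end PoincareForm

/-! ### Wick polynomials in the Chebyshev class -/

section ChebyshevClass

/-- Chebyshev entries carry a coefficient on each side of every letter, Wick words only one between
neighbours. Setting the left entries after the first to `1` makes the two recursions agree. -/
theorem wick_eq_chebyshev {B : Type*} [Ring B] [Algebra ℂ B] {d : ℕ} (η : Fin d → B →ₗ[ℂ] B)
    (j : Fin d) (b c : B) (l : List (Fin d × B)) (hl : ∀ q ∈ l, q.1 = j) :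
    wick η b ((j, c) :: l) = chebyshev (η j) j ((b, c) :: l.map fun q => (1, q.2)) := by
  match l with
  | [] => simp [wick, chebyshev]
  | [q] =>
    have hq : q.1 = j := hl q (by simp)
    have h1 := wick_eq_chebyshev η j 1 q.2 [] (by simp)
    have h2 : wick η c [q] = NCPoly.C c * wick η 1 [(j, q.2)] := by
      rw [C_mul_wick, mul_one, ← hq]
    simp only [wick, hq, if_true, List.map_cons, List.map_nil, chebyshev, mul_one] at h1 h2 ⊢
    rw [h2, mul_assoc, mul_assoc]
    simp [mul_assoc]
  | q :: r :: l =>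
    have hq : q.1 = j := hl q (by simp)
    have hr : r.1 = j := hl r (by simp)
    have h1 := wick_eq_chebyshev η j 1 q.2 (r :: l) fun x hx => hl x (by simp_all)
    have h2 := wick_eq_chebyshev η j 1 r.2 l fun x hx => hl x (by simp_all)
    have h3 : wick η c (q :: r :: l) = NCPoly.C c * wick η 1 ((j, q.2) :: r :: l) := by
      rw [C_mul_wick, mul_one, ← hq]
    have h4 : wick η (b * η j c * q.2) (r :: l) =
        NCPoly.C (b * η j c * q.2) * wick η 1 ((j, r.2) :: l) := by
      rw [C_mul_wick, mul_one, ← hr]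
    rw [wick, if_pos hq, h3, h4, h1, h2]
    simp only [List.map_cons, chebyshev, mul_one, mul_assoc]
termination_by l.length

theorem diffQuot_wick_singleton {B : Type*} [Ring B] [Algebra ℂ B] {I : Type*} [DecidableEq I]
    (η : I → B →ₗ[ℂ] B) (j k : I) (b c : B) :
    diffQuot k (wick η b [(j, c)]) = if j = k then NCPoly.C b ⊗ₜ[ℂ] NCPoly.C c else 0 := by
  rw [diffQuot_wick]
  simp [splits, splitTensor, wick]

/-- The two terms have shapes `(j, 1)` and `(j, n)` with `n ≥ 2`, so no shape is repeated. These
sums are the only test polynomials that the converse direction needs. -/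
theorem add_wick_mem_chebyshevClass {B : Type*} [Ring B] [Algebra ℂ B] {d : ℕ}
    (η : Fin d → B →ₗ[ℂ] B) (j : Fin d) (b b' c : B) (l : List (Fin d × B)) (hl : ∀ q ∈ l, q.1 = j) (hn : 2 ≤ l.length) :
    wick η b [(j, c)] + wick η b' l ∈ chebyshevClass η := by
  match l with
  | q :: r :: l =>
    have hq : q.1 = j := hl q (by simp)
    refine ⟨0, [[(j, [(b, c)])], [(j, (b', q.2) :: (r :: l).map fun q => (1, q.2))]], ?_, ?_, ?_⟩
    · intro t ht
      simp only [List.mem_cons, List.not_mem_nil, or_false] at ht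
      rcases ht with rfl | rfl <;> simp [IsChebyshevTerm]
    · simp [termShape]
    · have h1 := wick_eq_chebyshev η j b c [] (by simp)
      have h2 := wick_eq_chebyshev η j b' q.2 (r :: l) fun x hx => hl x (by simp_all)
      have h3 : (j, q.2) = q := by rw [← hq]
      rw [h3] at h2
      rw [h1, h2]
      simp [termValue]

variable {A B : Type*} [CStarAlgebra A] [CStarAlgebra B] [PartialOrder B] [StarOrderedRing B]
  (V : TracialSpace A B)

/-- If the Poincaré inequality holds on the Chebyshev class, then the Wick polynomials in a single
variable are centred. -/
theorem E_wick_eq_zero_of_poincare {d : ℕ} {η : Fin d → (B →CP B)} {S : Fin d → A}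
    (hη : ∀ j b, η j (star b) = star (η j b)) (hS : ∀ j, IsSelfAdjoint (S j))
    (S_mean : ∀ j, V.E (S j) = 0) (S_variance : ∀ j b, V.E (S j * V.incl b * S j) = η j b)
    (h : ∀ P ∈ chebyshevClass (fun j => (η j).toLinearMap), PoincareInequality V η S P)
    (j : Fin d) (b : B) (l : List (Fin d × B)) (hl : ∀ q ∈ l, q.1 = j) (hne : l ≠ []) :
    V.E (ev V S (wick (fun j => (η j).toLinearMap) b l)) = 0 := by
  set η' : Fin d → B →ₗ[ℂ] B := fun j => (η j).toLinearMap with hη'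
  have hvar : ∀ j b, V.E (S j * V.incl b * S j) = η' j b := S_variance
  have one_case : ∀ b c, V.E (ev V S (wick η' b [(j, c)])) = 0 := by
    intro b c
    simp [wick, ev_C, ev_X, V.E_incl_mul, V.E_mul_incl, S_mean]
  induction hn : l.length using Nat.strong_induction_on generalizing b l with
  | _ n ih =>
    have step : ∀ c l, (∀ q ∈ l, q.1 = j) → l.length < n → 2 ≤ l.length →
        V.E (S j * ev V S (wick η' c l)) = 0 := by
      intro c l hl hln hl2
      have hE : V.E (ev V S (wick η' c l)) = 0 :=
        ih l.length (by omega) c l hl (by rintro rfl; simp at hl2) rfl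
      set e := V.E (S j * ev V S (wick η' c l)) with he
      -- Words of length one are extremal: both sides of the inequality equal `τ(e* η(1) e)`.
      have hP : poincareForm V η' S (wick η' 1 [(j, e)]) (wick η' 1 [(j, e)]) = 0 := by
        have h1 : ∀ k, etaInner V (η' k)
            (Algebra.TensorProduct.map (ev V S) (ev V S) (diffQuot k (wick η' 1 [(j, e)])))
            (Algebra.TensorProduct.map (ev V S) (ev V S) (diffQuot k (wick η' 1 [(j, e)]))) =
            if j = k then V.τ (V.incl (star e * η' j 1 * e)) else 0 := by
          intro k
          by_cases hk : j = k
          · have hE1 := V.E_incl 1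
            rw [map_one] at hE1
            simp [diffQuot_wick_singleton, hk, etaInner_tmul, hE1, map_star, ev_C]
          · simp [diffQuot_wick_singleton, hk, etaInner_zero_left]
        have h2 : V.E (star (ev V S (wick η' 1 [(j, e)])) * ev V S (wick η' 1 [(j, e)])) =
            star e * η' j 1 * e := by
          have h3 := hvar j 1
          simp only [map_one, mul_one] at h3
          simp only [wick, map_mul, ev_C, ev_X, map_one, one_mul, star_mul, (hS j).star_eq]
          rw [← h3, ← map_star, ← V.E_bimodule]
          simp only [mul_assoc]
        rw [poincareForm, one_case, map_zero, sub_zero, ← V.τ_E, h2]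
        simp [h1]
      have hF : poincareForm V η' S (wick η' 1 [(j, e)]) (wick η' c l) = 0 := by
        refine poincareForm_eq_zero V S hη hP fun r => ?_
        -- The scalar goes into the leading coefficient, so the perturbed polynomial is still a sum
        -- of two Chebyshev terms.
        rw [← wick_smul]
        exact (poincareInequality_iff V S η _).mp
          (h _ (add_wick_mem_chebyshevClass η' j 1 (r • c) e l hl hl2))
      -- Each split of `l` contributes `τ(e* η(E[left leg]) right leg)`. The two legs are shorter
      -- than `l` and, as `l` has at least two letters, not both are empty; the induction hypothesis
      -- centres a nonempty one.
      have hT : ∀ k, etaInner V (η' k)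
          (Algebra.TensorProduct.map (ev V S) (ev V S) (diffQuot k (wick η' 1 [(j, e)])))
          (Algebra.TensorProduct.map (ev V S) (ev V S) (diffQuot k (wick η' c l))) = 0 := by
        intro k
        rw [diffQuot_wick η' k c l, map_list_sum, etaInner_list_sum_right]
        refine List.sum_eq_zero fun y hy => ?_
        simp only [List.map_map, List.mem_map, Function.comp_apply] at hy
        obtain ⟨x, hx, rfl⟩ := hy
        have hlen := length_of_mem_splits hx
        have hsub := subset_of_mem_splits hx
        by_cases hjk : j = k
        · by_cases hxk : x.1.1 = k
          · have h1 : diffQuot k (wick η' 1 [(j, e)]) = 1 ⊗ₜ NCPoly.C e := by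
              simp [diffQuot_wick_singleton, hjk]
            rw [h1, splitTensor, if_pos hxk, Algebra.TensorProduct.map_tmul,
              Algebra.TensorProduct.map_tmul, etaInner_tmul, map_one, star_one, one_mul, ev_C]
            by_cases hx0 : x.1.2 = []
            · rw [← map_star, ← map_mul, ← V.τ_E, V.E_incl_mul,
                ih x.2.2.length (by omega) _ _ (fun q hq => hl q (hsub.2 hq))
                  (by intro h0; rw [hx0, h0] at hlen; simp at hlen; omega) rfl]
              simp
            · rw [ih x.1.2.length (by omega) _ _ (fun q hq => hl q (hsub.1 hq)) hx0 rfl]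
              simp
          · simp [splitTensor, hxk, etaInner_zero_right]
        · simp [diffQuot_wick_singleton, hjk, etaInner_zero_left]
      rw [poincareForm, Finset.sum_eq_zero fun k _ => hT k, one_case, hE, map_zero, sub_zero,
        sub_zero, zero_sub, neg_eq_zero] at hF
      -- Only `-τ((S j e)* W)` is left of the mixed term, and it equals `-τ(e* e)` by the choice of
      -- `e`.
      have hτ : V.τ (star (V.incl e) * V.incl e) = 0 := by
        rw [← hF, ← V.τ_E (star (ev V S _) * _), ← map_star, ← map_mul]
        congr 2
        simp only [wick, map_mul, ev_C, ev_X, map_one, one_mul, star_mul, (hS j).star_eq]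
        rw [mul_assoc, ← map_star V.incl, V.E_incl_mul]
      have h0 := V.τ_faithful _ hτ
      rw [← map_zero V.incl] at h0
      exact V.incl_injective h0
    match l with
    | [] => exact absurd rfl hne
    | [q] =>
      have hq : (j, q.2) = q := by rw [← hl q (by simp)]
      rw [← hq]
      exact one_case b q.2
    -- Length two is the variance hypothesis; the perturbation argument would need a word of length
    -- one as `W`, which repeats the shape of `X j e`.
    | [q, r] =>
      have hq : q.1 = j := hl q (by simp)
      have hr : r.1 = j := hl r (by simp)
      have h1 := hvar j q.2
      simp only [wick, hq, hr, if_true, map_sub, map_mul, ev_C, ev_X]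
      rw [show V.incl b * S j * (V.incl q.2 * S j * V.incl r.2) =
        V.incl b * (S j * V.incl q.2 * S j) * V.incl r.2 by simp only [mul_assoc], V.E_bimodule, h1,
        ← map_mul, ← map_mul, V.E_incl, sub_self]
    | q :: r :: t :: l =>
      have hq : q.1 = j := hl q (by simp)
      have hr : r.1 = j := hl r (by simp)
      simp only [List.length_cons] at hn
      have h1 := step q.2 (r :: t :: l) (fun x hx => hl x (List.mem_cons_of_mem _ hx))
        (by simp only [List.length_cons]; omega) (by simp)
      rw [wick, hq, if_pos hr, map_sub, map_sub, map_mul (ev V S), map_mul (ev V S), ev_C, ev_X,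
        mul_assoc, V.E_incl_mul, h1,
        ih (t :: l).length (by simp only [List.length_cons]; omega) _ (t :: l)
          (fun x hx => hl x (List.mem_cons_of_mem _ (List.mem_cons_of_mem _ hx))) (by simp) rfl]
      simp

end ChebyshevClass

end BValued

theorem mainTheorem1 {A B : Type*} [CStarAlgebra A] [CStarAlgebra B] [PartialOrder B]
    [StarOrderedRing B] (V : BValued.TracialSpace A B) (d : ℕ)
    (η : Fin d → CompletelyPositiveMap B B)
    (η_symm : ∀ j b c, V.τ (V.incl (η j b * c)) = V.τ (V.incl (b * η j c)))
    (S : Fin d → A) (S_selfAdjoint : ∀ j, IsSelfAdjoint (S j)) (S_free : BValued.BFree V S)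
    (S_mean : ∀ j, V.E (S j) = 0)
    (S_variance : ∀ j b, V.E (S j * V.incl b * S j) = η j b) :
    List.TFAE
      [BValued.IsSemicircularSystem V η S,
        ∀ P ∈ BValued.chebyshevClass (fun j => (η j).toLinearMap),
          BValued.PoincareInequality V η S P,
        ∀ P : BValued.NCPoly B (Fin d), BValued.PoincareInequality V η S P] := by
  -- Taking adjoints in the variance identity, with `S j` self-adjoint, shows that `η j` is
  -- Hermitian.
  have hη : ∀ j b, η j (star b) = star (η j b) := by
    intro j b
    rw [← S_variance, ← S_variance, ← V.E_star]
    simp [(S_selfAdjoint j).star_eq, map_star, mul_assoc]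
  tfae_have 1 → 3 := fun h P => BValued.poincareInequality_of_E_wick V hη S_selfAdjoint
    (BValued.E_wick_eq_zero V S_free fun j b m hm =>
      (BValued.isSemicircular_iff_wick (η j) (S_selfAdjoint j)).mp (h.2 j) b m hm) P
  tfae_have 3 → 2 := fun h P _ => h P
  tfae_have 2 → 1 := by
    refine fun h => ⟨S_free, fun j =>
      (BValued.isSemicircular_iff_wick (η j) (S_selfAdjoint j)).mpr fun b m hm => ?_⟩
    have h1 := BValued.ev_wick_reindex V (fun _ : Unit => j) (fun _ _ _ => rfl)
      (fun j => (η j).toLinearMap) S b m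
    rw [← h1]
    refine BValued.E_wick_eq_zero_of_poincare V hη S_selfAdjoint S_mean S_variance h j b _ ?_ ?_
    · intro q hq
      obtain ⟨x, _, rfl⟩ := List.mem_map.mp hq
      rfl
    · simpa using hm
  tfae_finish
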